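/- **Theorem (Averaging the empirical measure).** *Potentials.* Let $\beta\in\mathbb R$, $s>1$. Let $\mathbf A_e\in L^2(\mathbb R^2;\mathbb R^2)\cap W^{2,\infty}(\mathbb R^2;\mathbb R^2)$ (continuous representative; then $|\mathbf A_e|^2\in W^{1,\infty}\cap L^2$). Let $V:\mathbb R^2\to[0,\infty)$ be differentiable with $V(x)\ge c|x|^s-C_0$ and $|\nabla V(x)|\le c'|x|^{s-1}+C_0'$ for some constants $c>0$, $C_0,c',C_0'$. Let $\chi:\mathbb R^2\to[0,\infty)$ be smooth, radial and nonincreasing in $|x|$, with $\chi=1/\pi^2$ for $|x|\le1$, $\chi=0$ for $|x|\ge2$ and $\int\chi=1$. For $R>0$ put $\chi_R=R^{-2}\chi(\cdot/R)$, $w_R=\log|\cdot|*\chi_R$ and $\nabla^\perp=(-\partial_2,\partial_1)$. For a finite measure $\mu$ on $\mathbb R^2\times\mathbb R^2$ with position marginal $\rho$ let $\mathbf A^R[\rho]=\nabla^\perp w_R*\rho$ and $$\mathcal E^R_V[\mu]=\int\big|p+\mathbf A_e(x)+\beta\,\mathbf A^R[\rho](x)\big|^2\,d\mu(x,p)+\int_{\mathbb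 R^2}V\,d\rho .$$ *Grid.* For $l_x,l_p>0$ divide $\mathbb R^4$ into the half-open boxes $\Omega_m$ of the grid with vertices in $(l_x\mathbb Z)^2\times(l_p\mathbb Z)^2$, of side $l_x$ in the two position coordinates and $l_p$ in the two momentum coordinates. Let $S_L=[-L,L]^4$ and $$\mathrm{Ave}[\mu]=\sum_{\Omega_m\subset S_L}\frac{\mu(\Omega_m)}{|\Omega_m|}\,\mathbf 1_{\Omega_m}.$$ For $Z=(z_1,\dots,z_N)\in(\mathbb R^4)^N$ let $\mathrm{Emp}_Z=\frac1N\sum_{i=1}^N\delta_{z_i}$, and let $\Gamma_\varepsilon$ be the set of those $\mathrm{Emp}_Z$ for which some box $\Omega_m\subset S_L$ satisfies $\mathrm{Emp}_Z(\Omega_m)\ge\frac{1+\varepsilon}{(2\pi)^2}|\Omega_m|$. *Claim.* There is a constant $C>0$, depending only on $\mathbf A_e,V,s,\chi,\beta$, such that the following holds. Let $0<b<1$, $\varepsilon>0$, and let $R=R_N$, $l_x=l_x(N)$, $l_p=l_p(N)$ be positive with $$l_x^2l_p^2=N^{-b},\qquad R\to0,\qquad l_x/R\to0,\qquad l_p\to0\qquad(N\to\infty).$$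 Then there are sequences $o^{(1)}_N\to0$ and $o^{(2)}_N\to0$ such that for all $N\ge1$, $L>0$, $D\in\mathbb R$, $Z\in(\mathbb R^4)^N$ with $\mathrm{Emp}_Z\notin\Gamma_\varepsilon$ and $$\int\big(|p|^2+V(x)\big)\,d\mathrm{Emp}_Z(x,p)\le D,$$ and for all $\sigma>0$, $$\mathcal E^R_V[\mathrm{Emp}_Z]\ \ge\ (1-\sigma)\big(1-o^{(1)}_N\big)\,\mathcal E^R_V\big[\mathrm{Ave}[\mathrm{Emp}_Z]\big]-o^{(2)}_N-C\,\frac{D^2}{\sigma R^2\min(L^4,L^{2s})}.$$ -/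

import Mathlib

open MeasureTheory Filter Topology
open scoped ENNReal NNReal ContDiff Convolution

noncomputable section

namespace Anyons

/-- The Euclidean plane. -/
abbrev Plane : Type := EuclideanSpace ℝ (Fin 2)

/-- The phase space of positions and momenta `z = (x, p)`. -/
abbrev Phase : Type := Plane × Plane

/-- Rotation by a right angle: `(v₁, v₂)^⊥ = (-v₂, v₁)`. -/
def perp (v : Plane) : Plane := !₂[-v 1, v 0]

/-- The standing assumption on the external potentials.  The vector potential `Ae` is (the continuous
representative of) an element of `L² ∩ W^{2,∞}`, that is, `Ae` is square integrable, bounded and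
differentiable with a bounded Lipschitz derivative; then `|Ae|²` is automatically in
`W^{1,∞} ∩ L²`.  The scalar potential `V` is nonnegative and differentiable, it grows at least like
`|x|^s`, and its gradient grows at most like `|x|^(s-1)`. -/
structure ExternalPotentials (Ae : Plane → Plane) (V : Plane → ℝ) (s : ℝ) : Prop where
  memLp_Ae : MemLp Ae 2 volume
  bounded_Ae : ∃ M : ℝ, ∀ x, ‖Ae x‖ ≤ M
  differentiable_Ae : Differentiable ℝ Ae
  bounded_fderiv_Ae : ∃ M : ℝ, ∀ x, ‖fderiv ℝ Ae x‖ ≤ M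
  lipschitz_fderiv_Ae : ∃ K : ℝ≥0, LipschitzWith K (fderiv ℝ Ae)
  one_lt_s : 1 < s
  differentiable_V : Differentiable ℝ V
  nonneg_V : ∀ x, 0 ≤ V x
  growth_V : ∃ c C : ℝ, 0 < c ∧ ∀ x, c * ‖x‖ ^ s - C ≤ V x
  growth_gradient_V : ∃ c C : ℝ, ∀ x, ‖gradient V x‖ ≤ c * ‖x‖ ^ (s - 1) + C

/-- The smearing profile `χ`: smooth, radial and nonincreasing in `|x|`, equal to `1/π²` for
`|x| ≤ 1` and to `0` for `|x| ≥ 2` (so it is nonnegative), of unit mass. -/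
structure SmearingProfile (χ : Plane → ℝ) : Prop where
  smooth : ContDiff ℝ ∞ χ
  eq_inside : ∀ x, ‖x‖ ≤ 1 → χ x = 1 / Real.pi ^ 2
  eq_outside : ∀ x, 2 ≤ ‖x‖ → χ x = 0
  radial_antitone : ∀ x y, ‖x‖ ≤ ‖y‖ → χ y ≤ χ x
  integral_eq_one : ∫ x, χ x = 1

/-- `χ_R = R⁻² χ(· / R)`. -/
def smear (χ : Plane → ℝ) (R : ℝ) (x : Plane) : ℝ := 1 / R ^ 2 * χ (R⁻¹ • x)

/-- The Coulomb potential of a smeared unit charge, `w_R = log|·| * χ_R`. -/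
def coulomb (χ : Plane → ℝ) (R : ℝ) : Plane → ℝ :=
  (fun x : Plane => Real.log ‖x‖) ⋆[ContinuousLinearMap.mul ℝ ℝ, volume] (smear χ R)

/-- `∇^⊥ w_R = (-∂₂ w_R, ∂₁ w_R)`. -/
def perpGrad (χ : Plane → ℝ) (R : ℝ) (x : Plane) : Plane := perp (gradient (coulomb χ R) x)

/-- The vector potential `A^R[ρ] = ∇^⊥ w_R * ρ` of a measure `ρ` on the plane. -/
def vectorPotential (χ : Plane → ℝ) (R : ℝ) (ρ : Measure Plane) (x : Plane) : Plane :=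
  ∫ y, perpGrad χ R (x - y) ∂ρ

/-- The regularized Vlasov energy
`E_V^R[μ] = ∫ |p + Ae(x) + β A^R[ρ](x)|² dμ(x, p) + ∫ V dρ`, where `ρ` is the position marginal
of `μ`. -/
def vlasovEnergy (Ae : Plane → Plane) (V : Plane → ℝ) (β : ℝ) (χ : Plane → ℝ) (R : ℝ)
    (μ : Measure Phase) : ℝ :=
  (∫ z, ‖z.2 + Ae z.1 + β • vectorPotential χ R μ.fst z.1‖ ^ 2 ∂μ) + ∫ x, V x ∂μ.fst

/-- The empirical measure `(1/N) ∑ δ_{z_i}` of a configuration of `N` points in phase space. -/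
def emp {N : ℕ} (Z : Fin N → Phase) : Measure Phase :=
  (N : ℝ≥0∞)⁻¹ • ∑ i, Measure.dirac (Z i)

/-- The boxes of the grid of phase space: side `lx` in the position coordinates and `lp` in the
momentum coordinates.  They are half-open, so that they form a partition of the phase space. -/
def box (lx lp : ℝ) (m : (Fin 2 → ℤ) × (Fin 2 → ℤ)) : Set Phase :=
  {z | (∀ i, m.1 i * lx ≤ z.1 i ∧ z.1 i < (m.1 i + 1) * lx) ∧
       (∀ i, m.2 i * lp ≤ z.2 i ∧ z.2 i < (m.2 i + 1) * lp)}

/-- The phase-space cube `S_L = [-L, L]⁴`. -/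
def cube (L : ℝ) : Set Phase := {z | (∀ i, |z.1 i| ≤ L) ∧ (∀ i, |z.2 i| ≤ L)}

/-- The density `∑_m 1_{Ω_m} μ(Ω_m) / |Ω_m|`, where the sum runs over the boxes `Ω_m ⊆ S_L`. -/
def aveDensity (lx lp L : ℝ) (μ : Measure Phase) (z : Phase) : ℝ≥0∞ :=
  ∑' m : {m // box lx lp m ⊆ cube L},
    (box lx lp m.1).indicator (fun _ => μ (box lx lp m.1) / volume (box lx lp m.1)) z

/-- The local average `Ave[μ]` with respect to the grid, as a measure on the phase space. -/
def ave (lx lp L : ℝ) (μ : Measure Phase) : Measure Phase :=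
  volume.withDensity (aveDensity lx lp L μ)

/-- The set `Γ_ε` of empirical measures of `N` points that violate the Pauli bound with factor
`1 + ε` in at least one box contained in `S_L`. -/
def pauliViolating (N : ℕ) (lx lp L ε : ℝ) : Set (Measure Phase) :=
  {μ | (∃ Z : Fin N → Phase, μ = emp Z) ∧
    ∃ m, box lx lp m ⊆ cube L ∧
      (1 + ε) / (2 * Real.pi) ^ 2 * volume.real (box lx lp m) ≤ μ.real (box lx lp m)}

end Anyons

end

noncomputable section

namespace Anyons


/-! Write μ for the empirical measure and ν for its average. They give equal mass to every box
inside the cube, so integrals of functions that vary little over a box nearly agree. The delicate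
term is the self-generated field. Its kernel is bounded by C/(R+|x|), and its increments over a
distance d ≤ R by C d/(R+|x|)² (`SmearingProfile.exists_bound_perpGrad`), so averaging moves the
field by at most a multiple of l_x ∫ (R+|x-y|)⁻² dν. Bounding this integrand by R⁻² would require
l_x to be small against R². But outside Γ_ε the measure ν has bounded phase-space density, and a
bathtub argument (`integral_fst_le_of_density_le`) bounds the integral by a multiple of R⁻¹√(1+T),
where T is the kinetic energy of ν itself. The squared field error is then (l_x/R)²(1+T) up to a
constant: an error relative to the energy, for which l_x/R → 0 suffices.

This yields E[ν] ≤ (1+κ) E_in + (2κ+κ²)(1+E[ν]) with κ → 0, where E_in is the energy of the part of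
μ in the inner boxes (`ExternalPotentials.exists_vlasovEnergy_ave_le`). The particles outside change
the field by at most C/R times their mass, and Markov's inequality bounds that mass by a multiple of
D/min(L², L^s). Young's inequality with parameter σ turns this into the last error term
(`SmearingProfile.exists_innerEnergy_le`).

The mass bound needs L ≥ L₀. For smaller cubes the energy of ν is at most a constant times its mass,
uniformly in R. Either D ≥ √R, and the error term eventually exceeds that constant; or D < √R, and
the momenta are so small that the density bound forces the mass of ν to zero. The constant C does
not depend on ε, because ε-dependent constants enter only the two null sequences and the threshold
for N. -/

theorem finrank_plane : Module.finrank ℝ Plane = 2 := by simp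

/-! ### The logarithmic potential: local integrability and decay of its differences. -/

theorem integrableOn_inv_norm_ball (r : ℝ) :
    IntegrableOn (fun x : Plane => ‖x‖⁻¹) (Metric.ball 0 r) := by
  have h : Integrable (fun x : Plane => (Set.Iio r).indicator (fun y : ℝ => y⁻¹) ‖x‖) := by
    rw [integrable_fun_norm_addHaar (volume : Measure Plane)
      (f := (Set.Iio r).indicator (fun y : ℝ => y⁻¹))]
    have h1 : IntegrableOn ((Set.Ioo 0 r).indicator (fun _ : ℝ => (1 : ℝ))) (Set.Ioi 0) := by
      apply Integrable.integrableOn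
      rw [integrable_indicator_iff measurableSet_Ioo]
      simp
    refine h1.congr_fun (fun y hy => ?_) measurableSet_Ioi
    have hy' : (0 : ℝ) < y := hy
    by_cases hr : y < r
    · simp [hr, hy', hy'.ne']
    · simp [hr]
  rw [← integrable_indicator_iff measurableSet_ball]
  refine h.congr (Eventually.of_forall fun x => ?_)
  by_cases hx : ‖x‖ < r <;> simp [Set.indicator, hx]

theorem measurable_log_norm : Measurable (fun x : Plane => Real.log ‖x‖) :=
  Real.measurable_log.comp measurable_norm

theorem locallyIntegrable_log_norm :
    LocallyIntegrable (fun x : Plane => Real.log ‖x‖) := by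
  intro x
  refine ⟨Metric.ball 0 (‖x‖ + 1), Metric.isOpen_ball.mem_nhds (by simp), ?_⟩
  have h2 : IntegrableOn (fun _ : Plane => ‖x‖ + 1) (Metric.ball 0 (‖x‖ + 1)) := by
    exact integrableOn_const measure_ball_lt_top.ne
  refine Integrable.mono' ((integrableOn_inv_norm_ball (‖x‖ + 1)).add h2)
    measurable_log_norm.aestronglyMeasurable ?_
  filter_upwards [ae_restrict_mem measurableSet_ball] with y hy
  have hy' : ‖y‖ < ‖x‖ + 1 := by simpa using hy
  have h0 : 0 ≤ ‖y‖ := norm_nonneg y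
  simp only [Pi.add_apply, Real.norm_eq_abs]
  rcases h0.eq_or_lt with h | h
  · rw [← h]; simp; positivity
  · have h3 := Real.log_le_sub_one_of_pos h
    have h4 := Real.log_le_sub_one_of_pos (inv_pos.2 h)
    rw [Real.log_inv] at h4
    have := inv_pos.2 h
    exact abs_le.2 ⟨by linarith, by linarith⟩

theorem hasFDerivAt_log_norm {x : Plane} (hx : x ≠ 0) :
    HasFDerivAt (fun y : Plane => Real.log ‖y‖)
      (innerSL ℝ (EuclideanGeometry.inversion 0 1 x)) x := by
  have h1 : HasFDerivAt (fun y : Plane => Real.log (‖y‖ ^ 2)) ((‖x‖ ^ 2)⁻¹ • (2 • innerSL ℝ x)) x :=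
    (hasStrictFDerivAt_norm_sq x).hasFDerivAt.log (by simpa using hx)
  have h2 := h1.const_mul (1 / 2 : ℝ)
  have e : (fun y : Plane => Real.log ‖y‖) = fun y => 1 / 2 * Real.log (‖y‖ ^ 2) := by
    funext y; rw [Real.log_pow]; push_cast; ring
  rw [e]
  refine h2.congr_fderiv ?_
  ext v
  simp [EuclideanGeometry.inversion]
  ring

theorem norm_inversion_zero (x : Plane) :
    ‖EuclideanGeometry.inversion 0 1 x‖ = ‖x‖⁻¹ := by
  have := EuclideanGeometry.dist_inversion_center (0 : Plane) x 1
  simpa using this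

theorem norm_inversion_sub {x y : Plane} (hx : x ≠ 0) (hy : y ≠ 0) :
    ‖EuclideanGeometry.inversion 0 1 x - EuclideanGeometry.inversion 0 1 y‖
      = ‖x - y‖ / (‖x‖ * ‖y‖) := by
  have := EuclideanGeometry.dist_inversion_inversion hx hy 1
  rw [dist_eq_norm, dist_eq_norm] at this
  rw [this, dist_eq_norm x y, dist_zero_right, sub_zero]; ring

theorem log_norm_sub_le {x t : Plane} (hx : 4 ≤ ‖x‖) (ht : ‖t‖ ≤ 2) :
    |Real.log ‖x - t‖ - Real.log ‖x - 0‖| ≤ 4 / ‖x‖ := by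
  have key := Convex.norm_image_sub_le_of_norm_hasFDerivWithin_le (𝕜 := ℝ)
    (f := fun s : Plane => Real.log ‖x - s‖) (s := Metric.closedBall 0 2) (x := 0) (y := t)
    (C := 2 / ‖x‖)
    (f' := fun s => (innerSL ℝ (EuclideanGeometry.inversion 0 1 (x - s))).comp
      (-ContinuousLinearMap.id ℝ Plane)) ?_ ?_ (convex_closedBall _ _) (by simp) (by simpa using ht)
  · rw [Real.norm_eq_abs] at key
    refine key.trans ?_
    rw [sub_zero]
    calc 2 / ‖x‖ * ‖t‖ ≤ 2 / ‖x‖ * 2 := by gcongr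
      _ = 4 / ‖x‖ := by ring
  · intro s hs
    have hs' : ‖s‖ ≤ 2 := by simpa using hs
    have hne : x - s ≠ 0 := by
      intro h; rw [sub_eq_zero] at h; rw [h] at hx; linarith
    exact ((hasFDerivAt_log_norm hne).comp s
      ((hasFDerivAt_id s).const_sub x)).hasFDerivWithinAt
  · intro s hs
    have hs' : ‖s‖ ≤ 2 := by simpa using hs
    have hge : ‖x‖ / 2 ≤ ‖x - s‖ := by linarith [norm_sub_norm_le x s]
    have hne : x - s ≠ 0 := by
      intro h; rw [h, norm_zero] at hge; linarith
    rw [ContinuousLinearMap.comp_neg, norm_neg, ContinuousLinearMap.comp_id, innerSL_apply_norm,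
      norm_inversion_zero]
    rw [inv_eq_one_div, div_le_div_iff₀ (by linarith) (by linarith)]
    linarith

/-- Mean value inequality in t: the gradient of log|·| is inversion in the unit circle, and the
distance formula for inverted points supplies both the factor |x-x'| and the quadratic decay. -/
theorem log_norm_sub_sub_le {x x' t : Plane} (hx : 4 ≤ ‖x‖) (hxx : ‖x - x'‖ ≤ 1) (ht : ‖t‖ ≤ 2) :
    |(Real.log ‖x - t‖ - Real.log ‖x' - t‖) - (Real.log ‖x - 0‖ - Real.log ‖x' - 0‖)|
      ≤ 16 * ‖x - x'‖ / ‖x‖ ^ 2 := by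
  have key := Convex.norm_image_sub_le_of_norm_hasFDerivWithin_le (𝕜 := ℝ)
    (f := fun s : Plane => Real.log ‖x - s‖ - Real.log ‖x' - s‖) (s := Metric.closedBall 0 2)
    (x := 0) (y := t) (C := 8 * ‖x - x'‖ / ‖x‖ ^ 2)
    (f' := fun s => (innerSL ℝ (EuclideanGeometry.inversion 0 1 (x - s)
        - EuclideanGeometry.inversion 0 1 (x' - s))).comp
      (-ContinuousLinearMap.id ℝ Plane)) ?_ ?_ (convex_closedBall _ _) (by simp) (by simpa using ht)
  · rw [Real.norm_eq_abs] at key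
    refine key.trans ?_
    rw [sub_zero]
    calc 8 * ‖x - x'‖ / ‖x‖ ^ 2 * ‖t‖ ≤ 8 * ‖x - x'‖ / ‖x‖ ^ 2 * 2 := by gcongr
      _ = 16 * ‖x - x'‖ / ‖x‖ ^ 2 := by ring
  all_goals
    intro s hs
    have hs' : ‖s‖ ≤ 2 := by simpa using hs
    have hge : ‖x‖ / 2 ≤ ‖x - s‖ := by linarith [norm_sub_norm_le x s]
    have hge' : ‖x‖ / 4 ≤ ‖x' - s‖ := by
      linarith [norm_sub_norm_le x' s, norm_sub_norm_le x x']
    have hne : x - s ≠ 0 := by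
      intro h; rw [h, norm_zero] at hge; linarith
    have hne' : x' - s ≠ 0 := by
      intro h; rw [h, norm_zero] at hge'; linarith
  · have := ((hasFDerivAt_log_norm hne).comp s ((hasFDerivAt_id s).const_sub x)).sub
      ((hasFDerivAt_log_norm hne').comp s ((hasFDerivAt_id s).const_sub x'))
    rw [map_sub, ContinuousLinearMap.sub_comp]
    exact this.hasFDerivWithinAt
  · rw [ContinuousLinearMap.comp_neg, norm_neg, ContinuousLinearMap.comp_id, innerSL_apply_norm,
      norm_inversion_sub hne hne', sub_sub_sub_cancel_right]
    rw [div_le_div_iff₀ (by apply mul_pos <;> linarith) (by nlinarith)]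
    have h3 : ‖x‖ / 2 * (‖x‖ / 4) ≤ ‖x - s‖ * ‖x' - s‖ := by gcongr
    nlinarith [norm_nonneg (x - x')]

/-! ### The smeared kernel: size and increments. -/

section Profile

variable {χ : Plane → ℝ}

theorem SmearingProfile.tsupport_subset (hχ : SmearingProfile χ) :
    tsupport χ ⊆ Metric.closedBall 0 2 := by
  refine closure_minimal (fun x hx => ?_) Metric.isClosed_closedBall
  by_contra h
  have : 2 ≤ ‖x‖ := by
    have : ¬ ‖x‖ ≤ 2 := by simpa using h
    linarith
  exact hx (hχ.eq_outside x this)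

theorem SmearingProfile.hasCompactSupport (hχ : SmearingProfile χ) : HasCompactSupport χ :=
  (isCompact_closedBall (0 : Plane) 2).of_isClosed_subset (isClosed_tsupport χ) hχ.tsupport_subset

theorem SmearingProfile.fderiv_eq_zero (hχ : SmearingProfile χ) {t : Plane} (ht : 2 < ‖t‖) :
    fderiv ℝ χ t = 0 := by
  by_contra h
  have := hχ.tsupport_subset (support_fderiv_subset ℝ h)
  have : ‖t‖ ≤ 2 := by simpa using this
  linarith

theorem SmearingProfile.continuous_fderiv (hχ : SmearingProfile χ) : Continuous (fderiv ℝ χ) :=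
  hχ.smooth.continuous_fderiv (by simp)

theorem SmearingProfile.even (hχ : SmearingProfile χ) (x : Plane) : χ (-x) = χ x :=
  le_antisymm (hχ.radial_antitone _ _ (by simp)) (hχ.radial_antitone _ _ (by simp))

theorem SmearingProfile.integral_fderiv (hχ : SmearingProfile χ) (v : Plane) :
    ∫ t, fderiv ℝ χ t v = 0 := by
  have h1 : ∀ t, fderiv ℝ χ (-t) v = - fderiv ℝ χ t v := by
    intro t
    have h := fderiv_comp_smul (𝕜 := ℝ) (f := χ) (x := t) (c := (-1 : ℝ))
    have e : (fun x => χ ((-1 : ℝ) • x)) = χ := funext fun x => by simpa using hχ.even x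
    rw [e] at h
    rw [h]; simp
  have h2 := integral_neg_eq_self (fun t => fderiv ℝ χ t v) (volume : Measure Plane)
  simp_rw [h1, integral_neg] at h2
  linarith

/-- The Coulomb potential of a unit charge smeared at unit scale. -/
def unitCoulomb (χ : Plane → ℝ) : Plane → ℝ :=
  (fun x : Plane => Real.log ‖x‖) ⋆[ContinuousLinearMap.mul ℝ ℝ, volume] χ

theorem SmearingProfile.contDiff_unitCoulomb (hχ : SmearingProfile χ) :
    ContDiff ℝ ∞ (unitCoulomb χ) :=
  hχ.hasCompactSupport.contDiff_convolution_right _ locallyIntegrable_log_norm hχ.smooth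

theorem SmearingProfile.fderiv_unitCoulomb (hχ : SmearingProfile χ) (x v : Plane) :
    fderiv ℝ (unitCoulomb χ) x v = ∫ t, Real.log ‖x - t‖ * fderiv ℝ χ t v := by
  have h := hχ.hasCompactSupport.hasFDerivAt_convolution_right (ContinuousLinearMap.mul ℝ ℝ)
    locallyIntegrable_log_norm (hχ.smooth.of_le (by simp)) x
  rw [unitCoulomb, h.fderiv, convolution_precompR_apply _ locallyIntegrable_log_norm
    (hχ.hasCompactSupport.fderiv ℝ) hχ.continuous_fderiv, convolution_eq_swap]
  rfl

theorem SmearingProfile.integrable_log_mul_fderiv (hχ : SmearingProfile χ) (x v : Plane) :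
    Integrable (fun t => Real.log ‖x - t‖ * fderiv ℝ χ t v) := by
  have hc : HasCompactSupport (fun t => fderiv ℝ χ t v) :=
    (hχ.hasCompactSupport.fderiv ℝ).comp_left (g := fun l : Plane →L[ℝ] ℝ => l v) (by simp)
  have h := hc.convolutionExists_right (ContinuousLinearMap.mul ℝ ℝ)
    locallyIntegrable_log_norm (hχ.continuous_fderiv.clm_apply continuous_const) x
  simpa using h.integrable_swap

/-- Since χ is even, its derivative has mean zero, so the constant H 0 can be subtracted for free.
Only the oscillation of H over the support of χ counts; this is the source of the decay of the
kernel. -/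
theorem SmearingProfile.integral_mul_fderiv_le (hχ : SmearingProfile χ) (v : Plane)
    {H : Plane → ℝ} {c : ℝ} (hi : Integrable fun t => H t * fderiv ℝ χ t v)
    (hH : ∀ t, ‖t‖ ≤ 2 → |H t - H 0| ≤ c) :
    |∫ t, H t * fderiv ℝ χ t v| ≤ c * (∫ t, ‖fderiv ℝ χ t‖) * ‖v‖ := by
  have hI : Integrable (fun t => fderiv ℝ χ t v) :=
    (hχ.continuous_fderiv.clm_apply continuous_const).integrable_of_hasCompactSupport
      ((hχ.hasCompactSupport.fderiv ℝ).comp_left (g := fun l : Plane →L[ℝ] ℝ => l v) (by simp))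
  have hN : Integrable (fun t => ‖fderiv ℝ χ t‖) :=
    (hχ.continuous_fderiv.integrable_of_hasCompactSupport (hχ.hasCompactSupport.fderiv ℝ)).norm
  have e : ∫ t, H t * fderiv ℝ χ t v = ∫ t, (H t - H 0) * fderiv ℝ χ t v := by
    simp_rw [sub_mul]
    rw [integral_sub hi (hI.const_mul _), integral_const_mul, hχ.integral_fderiv]
    simp
  rw [e, ← Real.norm_eq_abs]
  have e2 : c * (∫ t, ‖fderiv ℝ χ t‖) * ‖v‖ = ∫ t, c * ‖fderiv ℝ χ t‖ * ‖v‖ := by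
    rw [integral_mul_const, integral_const_mul]
  rw [e2]
  refine norm_integral_le_of_norm_le ((hN.const_mul c).mul_const _) (Eventually.of_forall fun t => ?_)
  rw [norm_mul, mul_assoc]
  by_cases ht : ‖t‖ ≤ 2
  · have := (abs_nonneg _).trans (hH t ht)
    exact mul_le_mul (hH t ht) ((fderiv ℝ χ t).le_opNorm v) (norm_nonneg _) this
  · simp [hχ.fderiv_eq_zero (not_le.1 ht)]

theorem SmearingProfile.norm_fderiv_unitCoulomb_far (hχ : SmearingProfile χ) {x : Plane}
    (hx : 4 ≤ ‖x‖) :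
    ‖fderiv ℝ (unitCoulomb χ) x‖ ≤ 4 / ‖x‖ * ∫ t, ‖fderiv ℝ χ t‖ := by
  refine ContinuousLinearMap.opNorm_le_bound _ (by positivity) fun v => ?_
  rw [hχ.fderiv_unitCoulomb]
  exact hχ.integral_mul_fderiv_le v (H := fun t => Real.log ‖x - t‖)
    (hχ.integrable_log_mul_fderiv x v) fun t ht => log_norm_sub_le hx ht

theorem SmearingProfile.norm_fderiv_unitCoulomb_sub_far (hχ : SmearingProfile χ) {x x' : Plane}
    (hx : 4 ≤ ‖x‖) (hxx : ‖x - x'‖ ≤ 1) :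
    ‖fderiv ℝ (unitCoulomb χ) x - fderiv ℝ (unitCoulomb χ) x'‖
      ≤ 16 * ‖x - x'‖ / ‖x‖ ^ 2 * ∫ t, ‖fderiv ℝ χ t‖ := by
  refine ContinuousLinearMap.opNorm_le_bound _ (by positivity) fun v => ?_
  rw [sub_apply, hχ.fderiv_unitCoulomb, hχ.fderiv_unitCoulomb,
    ← integral_sub (hχ.integrable_log_mul_fderiv x v) (hχ.integrable_log_mul_fderiv x' v)]
  simp_rw [← sub_mul]
  refine hχ.integral_mul_fderiv_le v (H := fun t => Real.log ‖x - t‖ - Real.log ‖x' - t‖)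
    ?_ fun t ht => log_norm_sub_sub_le hx hxx ht
  simp_rw [sub_mul]
  exact (hχ.integrable_log_mul_fderiv x v).sub (hχ.integrable_log_mul_fderiv x' v)

/-- Beyond radius 4 the mean-zero cancellation gives the decay; inside, smoothness and compactness
suffice. The compact ball has radius 5 because x' may lie at distance 1 from a point of norm below
4. -/
theorem SmearingProfile.exists_bound_unitCoulomb (hχ : SmearingProfile χ) :
    ∃ C : ℝ, 0 < C ∧ (∀ x, ‖fderiv ℝ (unitCoulomb χ) x‖ ≤ C / (1 + ‖x‖)) ∧
      ∀ x x', ‖x - x'‖ ≤ 1 → ‖fderiv ℝ (unitCoulomb χ) x - fderiv ℝ (unitCoulomb χ) x'‖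
        ≤ C * ‖x - x'‖ / (1 + ‖x‖) ^ 2 := by
  have hd : ContDiff ℝ 1 (fderiv ℝ (unitCoulomb χ)) :=
    hχ.contDiff_unitCoulomb.fderiv_right (by norm_cast)
  obtain ⟨C₁, h₁⟩ := (isCompact_closedBall (0 : Plane) 5).exists_bound_of_continuousOn
    hd.continuous.continuousOn
  obtain ⟨C₂, h₂⟩ := (isCompact_closedBall (0 : Plane) 5).exists_bound_of_continuousOn
    (hd.continuous_fderiv (by simp)).continuousOn
  have hC₁ : 0 ≤ C₁ := (norm_nonneg _).trans (h₁ 0 (by simp))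
  have hC₂ : 0 ≤ C₂ := (norm_nonneg _).trans (h₂ 0 (by simp))
  set I := ∫ t, ‖fderiv ℝ χ t‖ with hI
  have hI0 : 0 ≤ I := integral_nonneg fun t => norm_nonneg _
  refine ⟨1 + 5 * C₁ + 25 * C₂ + 64 * I, by positivity, fun x => ?_, fun x x' hxx => ?_⟩
  · rw [le_div_iff₀ (by positivity)]
    rcases le_or_gt 4 ‖x‖ with hx | hx
    · have h := hχ.norm_fderiv_unitCoulomb_far hx
      calc _ ≤ 4 / ‖x‖ * I * (1 + ‖x‖) := by gcongr
        _ ≤ 4 / ‖x‖ * I * (2 * ‖x‖) := by gcongr; linarith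
        _ = 8 * I := by field_simp; ring
        _ ≤ _ := by linarith
    · have h := h₁ x (by simp; linarith)
      calc _ ≤ C₁ * 5 := by gcongr; linarith
        _ ≤ _ := by linarith
  · rw [le_div_iff₀ (by positivity)]
    rcases le_or_gt 4 ‖x‖ with hx | hx
    · have h := hχ.norm_fderiv_unitCoulomb_sub_far hx hxx
      calc _ ≤ 16 * ‖x - x'‖ / ‖x‖ ^ 2 * I * (1 + ‖x‖) ^ 2 := by gcongr
        _ ≤ 16 * ‖x - x'‖ / ‖x‖ ^ 2 * I * (2 * ‖x‖) ^ 2 := by gcongr; linarith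
        _ = 64 * I * ‖x - x'‖ := by field_simp; ring
        _ ≤ _ := by gcongr; linarith
    · have h := Convex.norm_image_sub_le_of_norm_fderiv_le (𝕜 := ℝ)
        (f := fderiv ℝ (unitCoulomb χ)) (s := Metric.closedBall 0 5) (x := x') (y := x)
        (fun y _ => hd.differentiable (by simp) y) h₂ (convex_closedBall _ _)
        (by simp; linarith [norm_sub_norm_le x' x, norm_sub_rev x x']) (by simp; linarith)
      calc _ ≤ C₂ * ‖x - x'‖ * 5 ^ 2 := by gcongr; linarith
        _ = 25 * C₂ * ‖x - x'‖ := by ring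
        _ ≤ _ := by gcongr; linarith

/-- Scaling log|·| costs only an additive constant, which the gradient forgets; every bound at scale
R thus reduces to R = 1. -/
theorem SmearingProfile.coulomb_eq (hχ : SmearingProfile χ) {R : ℝ} (hR : 0 < R) (x : Plane) :
    coulomb χ R x = Real.log R + unitCoulomb χ (R⁻¹ • x) := by
  have hint : Integrable (fun t => Real.log ‖t‖ * χ (R⁻¹ • x - t)) := by
    have h := hχ.hasCompactSupport.convolutionExists_right (ContinuousLinearMap.mul ℝ ℝ)
      locallyIntegrable_log_norm hχ.smooth.continuous (R⁻¹ • x)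
    simpa [ConvolutionExistsAt] using h
  have hχi : Integrable (fun t => χ (R⁻¹ • x - t)) :=
    (hχ.smooth.continuous.integrable_of_hasCompactSupport hχ.hasCompactSupport).comp_sub_left _
  have h1 := Measure.integral_comp_smul (volume : Measure Plane)
    (fun t => Real.log ‖t‖ * smear χ R (x - t)) R
  have h2 : ∫ t : Plane, Real.log ‖R • t‖ * smear χ R (x - R • t)
      = (R ^ 2)⁻¹ * ∫ t : Plane, (Real.log R * χ (R⁻¹ • x - t)
        + Real.log ‖t‖ * χ (R⁻¹ • x - t)) := by
    rw [← integral_const_mul]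
    apply integral_congr_ae
    filter_upwards [Measure.ae_ne volume (0 : Plane)] with t ht
    have : R⁻¹ • (x - R • t) = R⁻¹ • x - t := by
      rw [smul_sub, smul_smul, inv_mul_cancel₀ hR.ne', one_smul]
    simp only [smear]
    rw [this, norm_smul, Real.norm_of_nonneg hR.le,
      Real.log_mul hR.ne' (norm_ne_zero_iff.2 ht)]
    ring
  rw [h2, integral_add (hχi.const_mul _) hint, integral_const_mul,
    integral_sub_left_eq_self χ volume, hχ.integral_eq_one, mul_one, finrank_plane,
    abs_of_pos (by positivity), smul_eq_mul] at h1
  have h3 := mul_left_cancel₀ (by positivity) h1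
  simp only [coulomb, unitCoulomb, convolution, ContinuousLinearMap.mul_apply']
  exact h3.symm

theorem SmearingProfile.fderiv_coulomb (hχ : SmearingProfile χ) {R : ℝ} (hR : 0 < R) (x : Plane) :
    fderiv ℝ (coulomb χ R) x = R⁻¹ • fderiv ℝ (unitCoulomb χ) (R⁻¹ • x) := by
  have e : coulomb χ R = fun x => Real.log R + unitCoulomb χ (R⁻¹ • x) :=
    funext (hχ.coulomb_eq hR)
  rw [e, fderiv_const_add, fderiv_comp_smul]

theorem norm_perp (v : Plane) : ‖perp v‖ = ‖v‖ := by
  simp [perp, EuclideanSpace.norm_eq, add_comm]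

theorem perp_sub (v w : Plane) : perp (v - w) = perp v - perp w := by
  ext i; fin_cases i <;> simp [perp]; ring

theorem continuous_perp : Continuous perp := by
  have : LipschitzWith 1 perp := LipschitzWith.of_dist_le_mul fun v w => by
    rw [dist_eq_norm, dist_eq_norm, ← perp_sub, norm_perp]; simp
  exact this.continuous

theorem SmearingProfile.norm_perpGrad_sub (hχ : SmearingProfile χ) {R : ℝ} (hR : 0 < R)
    (x x' : Plane) : ‖perpGrad χ R x - perpGrad χ R x'‖
      = R⁻¹ * ‖fderiv ℝ (unitCoulomb χ) (R⁻¹ • x) - fderiv ℝ (unitCoulomb χ) (R⁻¹ • x')‖ := by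
  simp only [perpGrad]
  rw [← perp_sub, norm_perp, gradient, gradient, ← map_sub, LinearIsometryEquiv.norm_map,
    hχ.fderiv_coulomb hR, hχ.fderiv_coulomb hR, ← smul_sub, norm_smul,
    Real.norm_of_nonneg (by positivity)]

theorem SmearingProfile.norm_perpGrad (hχ : SmearingProfile χ) {R : ℝ} (hR : 0 < R)
    (x : Plane) : ‖perpGrad χ R x‖ = R⁻¹ * ‖fderiv ℝ (unitCoulomb χ) (R⁻¹ • x)‖ := by
  simp only [perpGrad]
  rw [norm_perp, gradient, LinearIsometryEquiv.norm_map,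
    hχ.fderiv_coulomb hR, norm_smul, Real.norm_of_nonneg (by positivity)]

theorem SmearingProfile.continuous_perpGrad (hχ : SmearingProfile χ) {R : ℝ} (hR : 0 < R) :
    Continuous (perpGrad χ R) := by
  refine continuous_perp.comp ((LinearIsometryEquiv.continuous _).comp ?_)
  have e : fderiv ℝ (coulomb χ R) = fun x => R⁻¹ • fderiv ℝ (unitCoulomb χ) (R⁻¹ • x) :=
    funext (hχ.fderiv_coulomb hR)
  rw [e]
  have := hχ.contDiff_unitCoulomb.continuous_fderiv (by simp)
  fun_prop

/-- Size and regularity of `∇^⊥ w_R`, uniformly in the scale `R`. -/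
theorem SmearingProfile.exists_bound_perpGrad (hχ : SmearingProfile χ) :
    ∃ C : ℝ, 0 < C ∧ ∀ R, 0 < R → (∀ x, ‖perpGrad χ R x‖ ≤ C / (R + ‖x‖)) ∧
      ∀ x x', ‖x - x'‖ ≤ R →
        ‖perpGrad χ R x - perpGrad χ R x'‖ ≤ C * ‖x - x'‖ / (R + ‖x‖) ^ 2 := by
  obtain ⟨C, hC, h1, h2⟩ := hχ.exists_bound_unitCoulomb
  refine ⟨C, hC, fun R hR => ⟨fun x => ?_, fun x x' hxx => ?_⟩⟩
  · rw [hχ.norm_perpGrad hR]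
    refine (mul_le_mul_of_nonneg_left (h1 _) (by positivity)).trans_eq ?_
    rw [norm_smul, Real.norm_of_nonneg (by positivity)]
    field_simp
  · rw [hχ.norm_perpGrad_sub hR]
    have e : ‖R⁻¹ • x - R⁻¹ • x'‖ = R⁻¹ * ‖x - x'‖ := by
      rw [← smul_sub, norm_smul, Real.norm_of_nonneg (by positivity)]
    refine (mul_le_mul_of_nonneg_left (h2 _ _ ?_) (by positivity)).trans_eq ?_
    · rw [e]; field_simp; linarith
    · rw [e, norm_smul, Real.norm_of_nonneg (by positivity)]
      field_simp

end Profile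


/-! ### Comparison of measures that agree on the blocks of a partition. -/

section Blocks

variable {α ι : Type*} [MeasurableSpace α] [Countable ι] {B : ι → Set α} {μ ν : Measure α}

/-- Two measures giving the same mass to the blocks of a partition can be compared blockwise. -/
theorem setIntegral_le_setIntegral_of_blocks (hm : ∀ i, MeasurableSet (B i))
    (hd : Pairwise (Function.onFun Disjoint B)) (hB : ∀ i, μ (B i) = ν (B i))
    (hfin : ∀ i, μ (B i) ≠ ⊤) {f g : α → ℝ} (hf : IntegrableOn f (⋃ i, B i) μ)
    (hg : IntegrableOn g (⋃ i, B i) ν) (h : ∀ i, ∀ z ∈ B i, ∀ z' ∈ B i, f z ≤ g z') :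
    ∫ z in ⋃ i, B i, f z ∂μ ≤ ∫ z in ⋃ i, B i, g z ∂ν := by
  refine hasSum_le (fun i => ?_) (hasSum_integral_iUnion hm hd hf) (hasSum_integral_iUnion hm hd hg)
  have hfi := hf.mono_set (Set.subset_iUnion B i)
  have hgi := hg.mono_set (Set.subset_iUnion B i)
  rcases (B i).eq_empty_or_nonempty with he | ⟨z₀, hz₀⟩
  · simp [he]
  -- The supremum of f over the block separates f from g, and a constant has the same integral for
  -- both measures.
  have hb : BddAbove (f '' B i) := ⟨g z₀, by rintro _ ⟨z, hz, rfl⟩; exact h i z hz z₀ hz₀⟩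
  calc ∫ z in B i, f z ∂μ ≤ ∫ _ in B i, sSup (f '' B i) ∂μ :=
        setIntegral_mono_on hfi (integrableOn_const (hfin i)) (hm i)
          fun z hz => le_csSup hb ⟨z, hz, rfl⟩
    _ = ∫ _ in B i, sSup (f '' B i) ∂ν := by
        rw [setIntegral_const, setIntegral_const, measureReal_def, measureReal_def, hB i]
    _ ≤ ∫ z in B i, g z ∂ν :=
        setIntegral_mono_on (integrableOn_const (hB i ▸ hfin i)) hgi (hm i)
          fun z' hz' => csSup_le ⟨f z₀, z₀, hz₀, rfl⟩ (by rintro _ ⟨z, hz, rfl⟩; exact h i z hz z' hz')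

/-- The scalar comparison is applied to components along v, the difference of the two integrals;
this gives ‖v‖² ≤ ‖v‖ ∫ G, and ‖v‖ cancels. -/
theorem norm_setIntegral_sub_le_of_blocks {E : Type*} [NormedAddCommGroup E]
    [InnerProductSpace ℝ E] [CompleteSpace E] (hm : ∀ i, MeasurableSet (B i))
    (hd : Pairwise (Function.onFun Disjoint B)) (hB : ∀ i, μ (B i) = ν (B i))
    (hfin : ∀ i, μ (B i) ≠ ⊤) {F F' : α → E} {G : α → ℝ} (hF : IntegrableOn F (⋃ i, B i) μ)
    (hF' : IntegrableOn F' (⋃ i, B i) ν) (hG : IntegrableOn G (⋃ i, B i) ν)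
    (h : ∀ i, ∀ z ∈ B i, ∀ z' ∈ B i, ‖F z - F' z'‖ ≤ G z') :
    ‖∫ z in ⋃ i, B i, F z ∂μ - ∫ z in ⋃ i, B i, F' z ∂ν‖ ≤ ∫ z in ⋃ i, B i, G z ∂ν := by
  set v := ∫ z in ⋃ i, B i, F z ∂μ - ∫ z in ⋃ i, B i, F' z ∂ν with hv
  have h1 := setIntegral_le_setIntegral_of_blocks (μ := μ) (ν := ν) hm hd hB hfin
    (f := fun z => inner ℝ v (F z)) (g := fun z => inner ℝ v (F' z) + ‖v‖ * G z)
    (hF.const_inner v) ((hF'.const_inner v).add (hG.const_mul _)) ?_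
  · rw [integral_add (hF'.const_inner v) (hG.const_mul _), integral_inner hF, integral_inner hF',
      integral_const_mul] at h1
    have h2 : ‖v‖ * ‖v‖ ≤ ‖v‖ * ∫ z in ⋃ i, B i, G z ∂ν := by
      have h3 : inner ℝ v v = inner ℝ v (∫ z in ⋃ i, B i, F z ∂μ)
        - inner ℝ v (∫ z in ⋃ i, B i, F' z ∂ν) := inner_sub_right v _ _
      rw [← real_inner_self_eq_norm_mul_norm]
      linarith
    rcases (norm_nonneg v).eq_or_lt with h0 | h0
    · rw [← h0]
      -- If v = 0, the integral of G must still be shown nonnegative; G is known to be so only on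
      -- the blocks.
      have h3 := setIntegral_le_setIntegral_of_blocks (μ := ν) (ν := ν) hm hd (fun _ => rfl)
        (fun i => hB i ▸ hfin i) (f := fun _ => 0) (g := G) (integrable_zero _ _ _) hG
        fun i z hz z' hz' => (norm_nonneg _).trans (h i z hz z' hz')
      simpa using h3
    · exact le_of_mul_le_mul_left h2 h0
  · intro i z hz z' hz'
    have h4 : inner ℝ v (F z - F' z') ≤ ‖v‖ * G z' :=
      (real_inner_le_norm _ _).trans (mul_le_mul_of_nonneg_left (h i z hz z' hz') (norm_nonneg _))
    rw [inner_sub_right] at h4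
    linarith

end Blocks

/-! ### The bathtub bound from a bounded phase-space density. -/

section Bathtub

/-- A measure on phase space with density at most `M` has large momenta where its position
density is large. -/
theorem lintegral_fst_le_of_density_le {ν : Measure Phase} {M : ℝ≥0∞} (hν : ν ≤ M • volume)
    {a : Plane → Plane} (ha : Measurable a) {G : Plane → ℝ} (hG : Measurable G)
    (hG0 : ∀ x, 0 ≤ G x) {t : ℝ} (ht : 0 < t) :
    ∫⁻ z, ENNReal.ofReal (G z.1) ∂ν
      ≤ ENNReal.ofReal t⁻¹ * ∫⁻ z, ENNReal.ofReal (‖z.2 + a z.1‖ ^ 2) ∂ν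
        + M * (ENNReal.ofReal (Real.pi * t) * ∫⁻ x, ENNReal.ofReal (G x ^ 2)) := by
  -- Off S the integrand is at most t⁻¹‖p + a‖². On S, for fixed x, the momentum lies in a disc of
  -- area π t G(x), so the density bound leaves M π t ∫ G².
  set S : Set Phase := {z | ‖z.2 + a z.1‖ ^ 2 < t * G z.1} with hS
  have hSm : MeasurableSet S := measurableSet_lt (by fun_prop) (by fun_prop)
  have hpt : ∀ z : Phase, ENNReal.ofReal (G z.1)
      ≤ ENNReal.ofReal t⁻¹ * ENNReal.ofReal (‖z.2 + a z.1‖ ^ 2)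
        + S.indicator (fun z => ENNReal.ofReal (G z.1)) z := by
    intro z
    by_cases hz : z ∈ S
    · simp [hz]
    · have hz' : t * G z.1 ≤ ‖z.2 + a z.1‖ ^ 2 := not_lt.1 hz
      rw [← ENNReal.ofReal_mul (by positivity)]
      refine le_add_right (ENNReal.ofReal_le_ofReal ?_)
      rw [inv_mul_eq_div, le_div_iff₀ ht]
      linarith
  have h2 : ∫⁻ z, S.indicator (fun z => ENNReal.ofReal (G z.1)) z ∂(volume : Measure Phase)
      = ENNReal.ofReal (Real.pi * t) * ∫⁻ x, ENNReal.ofReal (G x ^ 2) := by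
    rw [Measure.volume_eq_prod, lintegral_prod _
      ((Measurable.indicator (by fun_prop) hSm).aemeasurable), ← lintegral_const_mul _ (by fun_prop)]
    refine lintegral_congr fun x => ?_
    have e : ∀ y : Plane, S.indicator (fun z : Phase => ENNReal.ofReal (G z.1)) (x, y)
        = (Metric.ball (-a x) (Real.sqrt (t * G x))).indicator
          (fun _ => ENNReal.ofReal (G x)) y := by
      intro y
      have : (x, y) ∈ S ↔ y ∈ Metric.ball (-a x) (Real.sqrt (t * G x)) := by
        rw [mem_ball_iff_norm, sub_neg_eq_add, Real.lt_sqrt (norm_nonneg _)]; rfl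
      by_cases hy : (x, y) ∈ S
      · rw [Set.indicator_of_mem hy, Set.indicator_of_mem (this.1 hy)]
      · rw [Set.indicator_of_notMem hy, Set.indicator_of_notMem (mt this.2 hy)]
    simp_rw [e]
    rw [lintegral_indicator_const measurableSet_ball, EuclideanSpace.volume_ball_fin_two,
      ← ENNReal.ofReal_pow (Real.sqrt_nonneg _), Real.sq_sqrt (mul_nonneg ht.le (hG0 x)),
      ← ENNReal.ofReal_mul (mul_nonneg ht.le (hG0 x)), ← ENNReal.ofReal_mul (hG0 x),
      ← ENNReal.ofReal_mul (by positivity)]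
    congr 1; ring
  calc ∫⁻ z, ENNReal.ofReal (G z.1) ∂ν
      ≤ ∫⁻ z, (ENNReal.ofReal t⁻¹ * ENNReal.ofReal (‖z.2 + a z.1‖ ^ 2)
        + S.indicator (fun z => ENNReal.ofReal (G z.1)) z) ∂ν := lintegral_mono hpt
    _ = ENNReal.ofReal t⁻¹ * ∫⁻ z, ENNReal.ofReal (‖z.2 + a z.1‖ ^ 2) ∂ν
        + ∫⁻ z, S.indicator (fun z => ENNReal.ofReal (G z.1)) z ∂ν := by
        rw [lintegral_add_left (by fun_prop), lintegral_const_mul _ (by fun_prop)]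
    _ ≤ _ := by
        gcongr
        refine (lintegral_mono' hν le_rfl).trans_eq ?_
        rw [lintegral_smul_measure, h2, smul_eq_mul]

theorem integral_fst_le_of_density_le {ν : Measure Phase} {M : ℝ} (hM : 0 ≤ M)
    (hν : ν ≤ ENNReal.ofReal M • volume) {a : Plane → Plane} (ha : Measurable a)
    {G : Plane → ℝ} (hG : Measurable G) (hG0 : ∀ x, 0 ≤ G x) {t : ℝ} (ht : 0 < t)
    (hi : Integrable (fun z => ‖z.2 + a z.1‖ ^ 2) ν) (hG2 : Integrable fun x => G x ^ 2) :
    ∫ z, G z.1 ∂ν ≤ t⁻¹ * ∫ z, ‖z.2 + a z.1‖ ^ 2 ∂ν + M * (Real.pi * t * ∫ x, G x ^ 2) := by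
  have h := lintegral_fst_le_of_density_le hν ha hG hG0 ht
  have h1 : 0 ≤ ∫ z, ‖z.2 + a z.1‖ ^ 2 ∂ν := integral_nonneg fun z => by positivity
  have h2 : 0 ≤ ∫ x, G x ^ 2 := integral_nonneg fun z => by positivity
  rw [← ofReal_integral_eq_lintegral_ofReal hi (Eventually.of_forall fun z => by positivity),
    ← ofReal_integral_eq_lintegral_ofReal hG2 (Eventually.of_forall fun z => by positivity),
    ← ENNReal.ofReal_mul (by positivity), ← ENNReal.ofReal_mul (by positivity),
    ← ENNReal.ofReal_mul hM, ← ENNReal.ofReal_add (by positivity) (by positivity)] at h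
  rw [integral_eq_lintegral_of_nonneg_ae (Eventually.of_forall fun z => hG0 _)
    (hG.comp measurable_fst).aestronglyMeasurable]
  exact ENNReal.toReal_le_of_le_ofReal (by positivity) h

end Bathtub

/-! ### The grid, its inner boxes and the averaged measure. -/

section Grid

variable {lx lp L : ℝ}

theorem norm_le_of_abs_le {v : Plane} {r : ℝ} (h : ∀ i, |v i| ≤ r) : ‖v‖ ≤ 2 * r := by
  have hr : 0 ≤ r := (abs_nonneg _).trans (h 0)
  rw [EuclideanSpace.norm_eq, Real.sqrt_le_left (by positivity)]
  simp only [Fin.sum_univ_two, Real.norm_eq_abs]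
  have h0 := pow_le_pow_left₀ (abs_nonneg _) (h 0) 2
  have h1 := pow_le_pow_left₀ (abs_nonneg _) (h 1) 2
  nlinarith [sq_nonneg r]

theorem measurableSet_box (m : (Fin 2 → ℤ) × (Fin 2 → ℤ)) : MeasurableSet (box lx lp m) := by
  simp only [box, Set.ofPred_and, Set.ofPred_forall]
  refine MeasurableSet.inter ?_ ?_ <;> refine MeasurableSet.iInter fun i => MeasurableSet.inter ?_ ?_
  · exact measurableSet_le (by fun_prop) (by fun_prop)
  · exact measurableSet_lt (by fun_prop) (by fun_prop)
  · exact measurableSet_le (by fun_prop) (by fun_prop)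
  · exact measurableSet_lt (by fun_prop) (by fun_prop)

theorem box_disjoint (hlx : 0 < lx) (hlp : 0 < lp) {m m' : (Fin 2 → ℤ) × (Fin 2 → ℤ)}
    {z : Phase} (hz : z ∈ box lx lp m) (hz' : z ∈ box lx lp m') : m = m' := by
  have key : ∀ {l x : ℝ} {a b : ℤ}, 0 < l → a * l ≤ x → x < (a + 1) * l → b * l ≤ x →
      x < (b + 1) * l → a = b := by
    intro l x a b hl h1 h2 h3 h4
    have h5 : (a : ℝ) < b + 1 := lt_of_mul_lt_mul_right (h1.trans_lt h4) hl.le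
    have h6 : (b : ℝ) < a + 1 := lt_of_mul_lt_mul_right (h3.trans_lt h2) hl.le
    norm_cast at h5 h6
    omega
  ext i
  · exact key hlx (hz.1 i).1 (hz.1 i).2 (hz'.1 i).1 (hz'.1 i).2
  · exact key hlp (hz.2 i).1 (hz.2 i).2 (hz'.2 i).1 (hz'.2 i).2

theorem exists_mem_box (hlx : 0 < lx) (hlp : 0 < lp) (z : Phase) : ∃ m, z ∈ box lx lp m := by
  have key : ∀ {l : ℝ} (x : ℝ), 0 < l → ⌊x / l⌋ * l ≤ x ∧ x < (⌊x / l⌋ + 1) * l := by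
    intro l x hl
    exact ⟨(le_div_iff₀ hl).1 (Int.floor_le _), (div_lt_iff₀ hl).1 (Int.lt_floor_add_one _)⟩
  exact ⟨(fun i => ⌊z.1 i / lx⌋, fun i => ⌊z.2 i / lp⌋), fun i => key _ hlx, fun i => key _ hlp⟩

theorem abs_sub_le_of_mem_box {m : (Fin 2 → ℤ) × (Fin 2 → ℤ)} {z z' : Phase}
    (hz : z ∈ box lx lp m) (hz' : z' ∈ box lx lp m) :
    (∀ i, |z.1 i - z'.1 i| ≤ lx) ∧ ∀ i, |z.2 i - z'.2 i| ≤ lp := by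
  refine ⟨fun i => abs_le.2 ?_, fun i => abs_le.2 ?_⟩
  · constructor <;> linarith [hz.1 i, hz'.1 i]
  · constructor <;> linarith [hz.2 i, hz'.2 i]

theorem norm_sub_le_of_mem_box {m : (Fin 2 → ℤ) × (Fin 2 → ℤ)} {z z' : Phase}
    (hz : z ∈ box lx lp m) (hz' : z' ∈ box lx lp m) :
    ‖z.1 - z'.1‖ ≤ 2 * lx ∧ ‖z.2 - z'.2‖ ≤ 2 * lp :=
  ⟨norm_le_of_abs_le (abs_sub_le_of_mem_box hz hz').1,
    norm_le_of_abs_le (abs_sub_le_of_mem_box hz hz').2⟩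

theorem volume_box_ne_zero (hlx : 0 < lx) (hlp : 0 < lp) (m : (Fin 2 → ℤ) × (Fin 2 → ℤ)) :
    volume (box lx lp m) ≠ 0 := by
  let U : Set Phase := {z | (∀ i, m.1 i * lx < z.1 i ∧ z.1 i < (m.1 i + 1) * lx) ∧
       (∀ i, m.2 i * lp < z.2 i ∧ z.2 i < (m.2 i + 1) * lp)}
  have hU : IsOpen U := by
    simp only [U, Set.ofPred_and, Set.ofPred_forall]
    refine IsOpen.inter ?_ ?_ <;> refine isOpen_iInter_of_finite fun i => IsOpen.inter ?_ ?_
    all_goals exact isOpen_lt (by fun_prop) (by fun_prop)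
  have hne : U.Nonempty := by
    refine ⟨(WithLp.toLp 2 fun i => (m.1 i + 1 / 2) * lx, WithLp.toLp 2 fun i => (m.2 i + 1 / 2) * lp),
      fun i => ?_, fun i => ?_⟩ <;> constructor <;> simp only <;> nlinarith
  have hsub : U ⊆ box lx lp m := fun z hz =>
    ⟨fun i => ⟨(hz.1 i).1.le, (hz.1 i).2⟩, fun i => ⟨(hz.2 i).1.le, (hz.2 i).2⟩⟩
  exact ((hU.measure_pos volume hne).trans_le (measure_mono hsub)).ne'

theorem cube_subset_closedBall (L : ℝ) : cube L ⊆ Metric.closedBall 0 (2 * L) := by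
  intro z hz
  rw [mem_closedBall_zero_iff, Prod.norm_def]
  exact max_le (norm_le_of_abs_le hz.1) (norm_le_of_abs_le hz.2)

theorem measurableSet_cube (L : ℝ) : MeasurableSet (cube L) := by
  have : IsClosed (cube L) := by
    simp only [cube, Set.ofPred_and, Set.ofPred_forall]
    refine IsClosed.inter ?_ ?_ <;> refine isClosed_iInter fun i => ?_
    all_goals exact isClosed_le (by fun_prop) (by fun_prop)
  exact this.measurableSet

theorem volume_cube_lt_top (L : ℝ) : volume (cube L) < ⊤ :=
  (measure_mono (cube_subset_closedBall L)).trans_lt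
    (isCompact_closedBall (0 : Phase) (2 * L)).measure_lt_top

/-- The boxes of the grid inside the cube. -/
def innerBox (lx lp L : ℝ) (m : {m // box lx lp m ⊆ cube L}) : Set Phase := box lx lp m.1

/-- The union of the boxes of the grid inside the cube. -/
def innerRegion (lx lp L : ℝ) : Set Phase := ⋃ m, innerBox lx lp L m

theorem measurableSet_innerBox (m : {m // box lx lp m ⊆ cube L}) :
    MeasurableSet (innerBox lx lp L m) := measurableSet_box _

theorem measurableSet_inner : MeasurableSet (innerRegion lx lp L) :=
  MeasurableSet.iUnion measurableSet_innerBox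

theorem inner_subset_cube : innerRegion lx lp L ⊆ cube L := Set.iUnion_subset fun m => m.2

theorem pairwise_disjoint_innerBox (hlx : 0 < lx) (hlp : 0 < lp) :
    Pairwise (Function.onFun Disjoint (innerBox lx lp L)) := by
  intro m m' hmm
  refine Set.disjoint_left.2 fun z hz hz' => hmm (Subtype.ext (box_disjoint hlx hlp hz hz'))

theorem mem_inner_of_abs_le (hlx : 0 < lx) (hlp : 0 < lp) {z : Phase}
    (h1 : ∀ i, |z.1 i| ≤ L - lx) (h2 : ∀ i, |z.2 i| ≤ L - lp) : z ∈ innerRegion lx lp L := by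
  obtain ⟨m, hm⟩ := exists_mem_box hlx hlp z
  refine Set.mem_iUnion.2 ⟨⟨m, fun w hw => ?_⟩, hm⟩
  have h := abs_sub_le_of_mem_box hw hm
  refine ⟨fun i => ?_, fun i => ?_⟩
  · linarith [abs_sub_abs_le_abs_sub (w.1 i) (z.1 i), h.1 i, h1 i]
  · linarith [abs_sub_abs_le_abs_sub (w.2 i) (z.2 i), h.2 i, h2 i]

variable {μ : Measure Phase}

theorem aveDensity_of_mem (hlx : 0 < lx) (hlp : 0 < lp) {m : {m // box lx lp m ⊆ cube L}}
    {z : Phase} (hz : z ∈ innerBox lx lp L m) :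
    aveDensity lx lp L μ z = μ (innerBox lx lp L m) / volume (innerBox lx lp L m) := by
  rw [aveDensity, tsum_eq_single m, Set.indicator_of_mem (by exact hz)]
  · rfl
  · intro m' hm'
    exact Set.indicator_of_notMem
      (fun h => hm' (Subtype.ext (box_disjoint hlx hlp h hz))) _

theorem aveDensity_of_notMem {z : Phase} (hz : z ∉ innerRegion lx lp L) :
    aveDensity lx lp L μ z = 0 := by
  rw [aveDensity, ENNReal.tsum_eq_zero]
  exact fun m => Set.indicator_of_notMem (fun h => hz (Set.mem_iUnion.2 ⟨m, h⟩)) _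

theorem ave_innerBox (hlx : 0 < lx) (hlp : 0 < lp) (m : {m // box lx lp m ⊆ cube L}) :
    ave lx lp L μ (innerBox lx lp L m) = μ (innerBox lx lp L m) := by
  rw [ave, withDensity_apply _ (measurableSet_innerBox m),
    setLIntegral_congr_fun (measurableSet_innerBox m) (fun z hz => aveDensity_of_mem hlx hlp hz),
    setLIntegral_const]
  refine ENNReal.div_mul_cancel (volume_box_ne_zero hlx hlp _) ?_
  exact ((measure_mono m.2).trans_lt (volume_cube_lt_top L)).ne

theorem ave_compl_inner : ave lx lp L μ (innerRegion lx lp L)ᶜ = 0 := by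
  rw [ave, withDensity_apply _ measurableSet_inner.compl,
    setLIntegral_congr_fun measurableSet_inner.compl (g := fun _ => 0)
      (fun z hz => aveDensity_of_notMem hz)]
  simp

theorem ave_restrict_inner : (ave lx lp L μ).restrict (innerRegion lx lp L) = ave lx lp L μ := by
  refine Measure.restrict_eq_self_of_ae_mem ?_
  change _ = (0 : ℝ≥0∞)
  exact ave_compl_inner

theorem ave_univ (hlx : 0 < lx) (hlp : 0 < lp) :
    ave lx lp L μ Set.univ = μ (innerRegion lx lp L) := by
  rw [← ave_restrict_inner, Measure.restrict_apply_univ, innerRegion,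
    measure_iUnion (pairwise_disjoint_innerBox hlx hlp) measurableSet_innerBox,
    measure_iUnion (pairwise_disjoint_innerBox hlx hlp) measurableSet_innerBox]
  simp_rw [ave_innerBox hlx hlp]

theorem ave_le_of_box_le (hlx : 0 < lx) (hlp : 0 < lp) {M : ℝ≥0∞}
    (h : ∀ m, box lx lp m ⊆ cube L → μ (box lx lp m) ≤ M * volume (box lx lp m)) :
    ave lx lp L μ ≤ M • volume.restrict (cube L) := by
  have h1 : aveDensity lx lp L μ ≤ (cube L).indicator fun _ => M := by
    intro z
    by_cases hz : z ∈ innerRegion lx lp L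
    · obtain ⟨m, hm⟩ := Set.mem_iUnion.1 hz
      rw [aveDensity_of_mem hlx hlp hm, Set.indicator_of_mem (inner_subset_cube hz)]
      exact ENNReal.div_le_of_le_mul (h _ m.2)
    · rw [aveDensity_of_notMem hz]; exact zero_le
  refine (withDensity_mono (Eventually.of_forall h1)).trans ?_
  rw [withDensity_indicator (measurableSet_cube L), withDensity_const]

end Grid

/-! ### Empirical measures. -/

section Emp

variable {N : ℕ} (Z : Fin N → Phase)

theorem isProbabilityMeasure_emp (hN : 1 ≤ N) : IsProbabilityMeasure (emp Z) := by
  constructor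
  simp only [emp, Measure.smul_apply, Measure.finsetSum_apply, measure_univ, smul_eq_mul,
    Finset.sum_const, Finset.card_univ, Fintype.card_fin, nsmul_eq_mul, mul_one]
  exact ENNReal.inv_mul_cancel (by simp; omega) (by simp)

/-- A finite sum of point masses integrates every function, measurable or not; no regularity has to
be checked on the empirical side. -/
theorem integrable_emp (hN : 1 ≤ N) {E : Type*} [NormedAddCommGroup E] (f : Phase → E) :
    Integrable f (emp Z) := by
  refine Integrable.smul_measure ?_ (by simp; omega)
  rw [integrable_finsetSum_measure]
  exact fun i _ => integrable_dirac (by simp)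

end Emp


/-! ### Growth and oscillation of the external potentials. -/

section Potentials

variable {Ae : Plane → Plane} {V : Plane → ℝ} {s : ℝ}

theorem ExternalPotentials.exists_rpow_le (h : ExternalPotentials Ae V s) :
    ∃ K : ℝ, 0 < K ∧ ∀ x, (1 + ‖x‖) ^ s ≤ K * (1 + V x) := by
  obtain ⟨c, C, hc, hV⟩ := h.growth_V
  have hs : 0 < s := by linarith [h.one_lt_s]
  refine ⟨2 ^ s * (1 + |C| / c + 1 / c), by positivity, fun x => ?_⟩
  have h1 : ‖x‖ ^ s ≤ (V x + |C|) / c := by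
    rw [le_div_iff₀ hc]; linarith [hV x, le_abs_self C]
  have h2 : (1 + ‖x‖) ^ s ≤ 2 ^ s * (1 + ‖x‖ ^ s) := by
    rcases le_total ‖x‖ 1 with hx | hx
    · calc (1 + ‖x‖) ^ s ≤ 2 ^ s := by gcongr; linarith
        _ ≤ 2 ^ s * (1 + ‖x‖ ^ s) := le_mul_of_one_le_right (by positivity)
            (by linarith [Real.rpow_nonneg (norm_nonneg x) s])
    · calc (1 + ‖x‖) ^ s ≤ (2 * ‖x‖) ^ s := by gcongr; linarith
        _ = 2 ^ s * ‖x‖ ^ s := Real.mul_rpow (by norm_num) (norm_nonneg x)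
        _ ≤ 2 ^ s * (1 + ‖x‖ ^ s) := by gcongr; linarith
  refine h2.trans ?_
  rw [mul_assoc]
  refine mul_le_mul_of_nonneg_left ?_ (by positivity)
  have hVx := h.nonneg_V x
  calc 1 + ‖x‖ ^ s ≤ 1 + (V x + |C|) / c := by linarith
    _ = 1 + |C| / c + 1 / c * V x := by ring
    _ ≤ (1 + |C| / c + 1 / c) * (1 + V x) := by
      have : 0 ≤ |C| / c := by positivity
      have : 0 ≤ 1 / c := by positivity
      nlinarith

/-- The growth of the gradient makes the relative oscillation of `V` at small scales small. -/
theorem ExternalPotentials.exists_V_le (h : ExternalPotentials Ae V s) :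
    ∃ K : ℝ, 0 < K ∧ ∀ x x', ‖x - x'‖ ≤ 1 → V x ≤ V x' + K * ‖x - x'‖ * (1 + V x') := by
  obtain ⟨K, hK, hle⟩ := h.exists_rpow_le
  obtain ⟨c, C, hg⟩ := h.growth_gradient_V
  have hs := h.one_lt_s
  -- The exponent s - 1 of the gradient bound is relaxed to s, because (1 + ‖x'‖)^s is what 1 + V x'
  -- controls.
  refine ⟨(|c| + |C| + 1) * K, by positivity, fun x x' hx => ?_⟩
  have key := Convex.norm_image_sub_le_of_norm_fderiv_le (𝕜 := ℝ) (f := V)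
    (s := Metric.closedBall x' 1) (x := x') (y := x) (C := (|c| + |C| + 1) * (1 + ‖x'‖) ^ s)
    (fun y _ => h.differentiable_V y) (fun y hy => ?_) (convex_closedBall _ _) (by simp)
    (by simpa [dist_eq_norm] using hx)
  · have h1 := (le_abs_self _).trans ((Real.norm_eq_abs _).symm.le.trans key)
    have h2 := hle x'
    have h3 : (|c| + |C| + 1) * (1 + ‖x'‖) ^ s * ‖x - x'‖
        ≤ (|c| + |C| + 1) * (K * (1 + V x')) * ‖x - x'‖ := by gcongr
    linarith
  · have hy' : ‖y‖ ≤ 1 + ‖x'‖ := by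
      have : ‖y - x'‖ ≤ 1 := by simpa [dist_eq_norm] using hy
      linarith [norm_sub_norm_le y x']
    have e : ‖fderiv ℝ V y‖ = ‖gradient V y‖ := by simp [gradient]
    have h1 : (1 : ℝ) ≤ (1 + ‖x'‖) ^ s :=
      Real.one_le_rpow (by linarith [norm_nonneg x']) (by linarith)
    have h2 : ‖y‖ ^ (s - 1) ≤ (1 + ‖x'‖) ^ s :=
      (Real.rpow_le_rpow (norm_nonneg _) hy' (by linarith)).trans
        (Real.rpow_le_rpow_of_exponent_le (by linarith [norm_nonneg x']) (by linarith))
    have h3 := Real.rpow_nonneg (norm_nonneg y) (s - 1)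
    rw [e]
    calc ‖gradient V y‖ ≤ c * ‖y‖ ^ (s - 1) + C := hg y
      _ ≤ |c| * (1 + ‖x'‖) ^ s + |C| * (1 + ‖x'‖) ^ s := by
        have h4 : c * ‖y‖ ^ (s - 1) ≤ |c| * (1 + ‖x'‖) ^ s :=
          mul_le_mul (le_abs_self c) h2 h3 (abs_nonneg c)
        have h5 : C ≤ |C| * (1 + ‖x'‖) ^ s :=
          (le_abs_self C).trans (le_mul_of_one_le_right (abs_nonneg C) h1)
        linarith
      _ ≤ _ := by linarith

theorem ExternalPotentials.exists_lipschitz_Ae (h : ExternalPotentials Ae V s) :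
    ∃ K : ℝ, 0 < K ∧ ∀ x x', ‖Ae x - Ae x'‖ ≤ K * ‖x - x'‖ := by
  obtain ⟨M, hM⟩ := h.bounded_fderiv_Ae
  have h0 : 0 ≤ M := (norm_nonneg _).trans (hM 0)
  refine ⟨M + 1, by linarith, fun x x' => ?_⟩
  refine (Convex.norm_image_sub_le_of_norm_fderiv_le (𝕜 := ℝ) (s := Set.univ)
    (fun y _ => h.differentiable_Ae y) (fun y _ => hM y) convex_univ trivial trivial).trans ?_
  gcongr
  linarith

/-- Outside of the boxes in the cube `S_L`, either the momentum or the potential is large. -/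
theorem ExternalPotentials.exists_le_of_notMem_inner (h : ExternalPotentials Ae V s) :
    ∃ L₀ c : ℝ, 2 ≤ L₀ ∧ 0 < c ∧ ∀ L lx lp : ℝ, L₀ ≤ L → 0 < lx → lx ≤ 1 → 0 < lp → lp ≤ 1 →
      ∀ z ∉ innerRegion lx lp L, c * min (L ^ 2) (L ^ s) ≤ ‖z.2‖ ^ 2 + V z.1 := by
  obtain ⟨c, C, hc, hV⟩ := h.growth_V
  have hs := h.one_lt_s
  -- This L₀ makes |C| at most half of c (L/2)^s, so the additive constant in the growth of V is
  -- absorbed.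
  refine ⟨2 + 4 * |C| / c, min (1 / 4) (c / 2 / 2 ^ s), by linarith [show 0 ≤ 4 * |C| / c by positivity],
    by positivity, fun L lx lp hL hlx hlx1 hlp hlp1 z hz => ?_⟩
  have h4 : 0 ≤ 4 * |C| / c := by positivity
  have hL2 : 2 ≤ L := by linarith
  have hm : 0 ≤ min (L ^ 2) (L ^ s) := by positivity
  -- Boxes have sides at most 1 ≤ L/2, so a point with all coordinates below L/2 lies in a box
  -- inside the cube.
  have hcase : (∃ i, L / 2 ≤ |z.1 i|) ∨ ∃ i, L / 2 ≤ |z.2 i| := by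
    by_contra hcon
    push Not at hcon
    exact hz (mem_inner_of_abs_le hlx hlp (fun i => by linarith [hcon.1 i])
      fun i => by linarith [hcon.2 i])
  rcases hcase with ⟨i, hi⟩ | ⟨i, hi⟩
  · have h1 : L / 2 ≤ ‖z.1‖ := hi.trans (PiLp.norm_apply_le z.1 i)
    have h2 : (L / 2) ^ s ≤ ‖z.1‖ ^ s := by gcongr
    have h3 : L / 2 ≤ (L / 2) ^ s := Real.self_le_rpow_of_one_le (by linarith) hs.le
    have h5 : |C| ≤ c / 2 * (L / 2) ^ s := by
      have : 4 * |C| / c ≤ L := by linarith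
      rw [div_le_iff₀ hc] at this
      nlinarith
    have h6 : (L / 2) ^ s = L ^ s / 2 ^ s := Real.div_rpow (by linarith) (by norm_num) s
    calc min (1 / 4) (c / 2 / 2 ^ s) * min (L ^ 2) (L ^ s) ≤ c / 2 / 2 ^ s * L ^ s := by
          gcongr <;> apply min_le_right
      _ = c / 2 * (L / 2) ^ s := by rw [h6]; ring
      _ ≤ c * ‖z.1‖ ^ s - C := by nlinarith [le_abs_self C]
      _ ≤ V z.1 := hV _
      _ ≤ _ := by linarith [sq_nonneg ‖z.2‖]
  · have h1 : L / 2 ≤ ‖z.2‖ := hi.trans (PiLp.norm_apply_le z.2 i)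
    calc min (1 / 4) (c / 2 / 2 ^ s) * min (L ^ 2) (L ^ s) ≤ 1 / 4 * L ^ 2 := by
          gcongr <;> apply min_le_left
      _ = (L / 2) ^ 2 := by ring
      _ ≤ ‖z.2‖ ^ 2 := by gcongr
      _ ≤ _ := by linarith [h.nonneg_V z.1]

end Potentials

/-! ### Effect of averaging on the vector potential. -/

section Average

variable {lx lp L : ℝ} {μ : Measure Phase}

theorem smul_restrict_le (M : ℝ≥0∞) (S : Set Phase) :
    M • (volume : Measure Phase).restrict S ≤ M • volume := by
  gcongr
  exact Measure.restrict_le_self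

theorem integrable_of_le_smul_restrict_cube {ν : Measure Phase} {M : ℝ≥0∞} (hM : M ≠ ⊤)
    (hν : ν ≤ M • volume.restrict (cube L)) {E : Type*} [NormedAddCommGroup E] {f : Phase → E}
    (hf : Continuous f) : Integrable f ν := by
  have h1 := (hf.continuousOn (s := Metric.closedBall 0 (2 * L))).integrableOn_compact
    (isCompact_closedBall (0 : Phase) (2 * L)) (μ := volume)
  exact ((h1.mono_set (cube_subset_closedBall L)).smul_measure hM).mono_measure hν

/-- The vector potential of (the position marginal of) a measure on the phase space. -/
def phaseField (χ : Plane → ℝ) (R : ℝ) (μ : Measure Phase) (x : Plane) : Plane :=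
  ∫ z, perpGrad χ R (x - z.1) ∂μ

variable {χ : Plane → ℝ} {R : ℝ}

theorem vectorPotential_fst (hχ : SmearingProfile χ) (hR : 0 < R) (μ : Measure Phase) (x : Plane) :
    vectorPotential χ R μ.fst x = phaseField χ R μ x := by
  rw [vectorPotential, Measure.fst, integral_map measurable_fst.aemeasurable]
  · rfl
  · exact ((hχ.continuous_perpGrad hR).comp (by fun_prop)).aestronglyMeasurable

theorem vlasovEnergy_eq {Ae : Plane → Plane} {V : Plane → ℝ} (hV : Continuous V) (β : ℝ)
    (hχ : SmearingProfile χ) (hR : 0 < R) (μ : Measure Phase) :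
    vlasovEnergy Ae V β χ R μ = ∫ z, ‖z.2 + Ae z.1 + β • phaseField χ R μ z.1‖ ^ 2 ∂μ
      + ∫ z, V z.1 ∂μ := by
  rw [vlasovEnergy]
  simp_rw [vectorPotential_fst hχ hR]
  rw [Measure.fst, integral_map measurable_fst.aemeasurable hV.aestronglyMeasurable]

theorem continuous_phaseField (hχ : SmearingProfile χ) (hR : 0 < R) (μ : Measure Phase)
    [IsFiniteMeasure μ] : Continuous (phaseField χ R μ) := by
  obtain ⟨C, hC, hk⟩ := hχ.exists_bound_perpGrad
  refine continuous_of_dominated (bound := fun _ => C / R) (fun x => ?_) (fun x => ?_)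
    (integrable_const _) ?_
  · exact ((hχ.continuous_perpGrad hR).comp (by fun_prop)).aestronglyMeasurable
  · refine Eventually.of_forall fun z => ((hk R hR).1 _).trans ?_
    gcongr
    linarith [norm_nonneg (x - z.1)]
  · exact Eventually.of_forall fun z => (hχ.continuous_perpGrad hR).comp (by fun_prop)

theorem integrable_pow_neg_four : Integrable fun y : Plane => ((1 + ‖y‖) ^ 4)⁻¹ := by
  have h := integrable_one_add_norm (E := Plane) (μ := volume) (r := 4) (by simp; norm_num)
  refine h.congr (Eventually.of_forall fun y => ?_)
  simp only
  rw [Real.rpow_neg (by positivity)]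
  norm_cast

theorem integral_inv_sq_sq (hR : 0 < R) (x : Plane) :
    Integrable (fun y : Plane => (((R + ‖x - y‖) ^ 2)⁻¹) ^ 2) ∧
      ∫ y : Plane, (((R + ‖x - y‖) ^ 2)⁻¹) ^ 2
        = (R ^ 2)⁻¹ * ∫ y : Plane, ((1 + ‖y‖) ^ 4)⁻¹ := by
  have e : ∀ y : Plane, (((R + ‖x - y‖) ^ 2)⁻¹) ^ 2
      = (R ^ 4)⁻¹ * ((1 + ‖R⁻¹ • (x - y)‖) ^ 4)⁻¹ := by
    intro y
    rw [norm_smul, Real.norm_of_nonneg (by positivity), inv_pow, ← pow_mul, ← mul_inv, ← mul_pow,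
      mul_add, mul_one, mul_inv_cancel_left₀ hR.ne']
  simp_rw [e]
  constructor
  · have h := (integrable_comp_smul_iff volume (fun y : Plane => ((1 + ‖y‖) ^ 4)⁻¹)
      (inv_ne_zero hR.ne')).2 integrable_pow_neg_four
    exact (h.comp_sub_left x).const_mul _
  · rw [integral_const_mul,
      integral_sub_left_eq_self (fun y : Plane => ((1 + ‖R⁻¹ • y‖) ^ 4)⁻¹) volume x,
      Measure.integral_comp_smul volume (fun y : Plane => ((1 + ‖y‖) ^ 4)⁻¹) R⁻¹, finrank_plane,
      abs_of_pos (by positivity), smul_eq_mul, ← mul_assoc]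
    congr 1
    field_simp

/-- Averaging over the grid changes the vector potential little, relative to the kinetic energy. -/
theorem SmearingProfile.exists_phaseField_sub_le (hχ : SmearingProfile χ) {M : ℝ} (hM : 0 ≤ M) :
    ∃ K : ℝ, 0 < K ∧ ∀ (R lx lp L : ℝ) (μ : Measure Phase) [IsFiniteMeasure μ] (a : Plane → Plane),
      0 < R → 0 < lx → 0 < lp → 4 * lx ≤ R → Continuous a →
      ave lx lp L μ ≤ ENNReal.ofReal M • volume.restrict (cube L) →
      ∀ m, box lx lp m ⊆ cube L → ∀ z ∈ box lx lp m, ∀ z' ∈ box lx lp m,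
        ‖phaseField χ R (μ.restrict (innerRegion lx lp L)) z.1 - phaseField χ R (ave lx lp L μ) z'.1‖
          ≤ K * (lx / R) * √(1 + ∫ w, ‖w.2 + a w.1‖ ^ 2 ∂(ave lx lp L μ)) := by
  obtain ⟨C, hC, hk⟩ := hχ.exists_bound_perpGrad
  set J := ∫ y : Plane, ((1 + ‖y‖) ^ 4)⁻¹ with hJ
  have hJ0 : 0 ≤ J := integral_nonneg fun y => by positivity
  refine ⟨4 * C * (1 + M * (Real.pi * J)), by positivity, ?_⟩
  intro R lx lp L μ _ a hR hlx hlp hlR ha hν m hmL z hz z' hz'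
  set ν := ave lx lp L μ with hνdef
  set T := ∫ w, ‖w.2 + a w.1‖ ^ 2 ∂ν with hT
  have hT0 : 0 ≤ T := integral_nonneg fun w => by positivity
  have hint : ∀ {f : Phase → ℝ}, Continuous f → Integrable f ν := fun hf =>
    integrable_of_le_smul_restrict_cube ENNReal.ofReal_ne_top hν hf
  have hint' : ∀ {f : Phase → Plane}, Continuous f → Integrable f ν := fun hf =>
    integrable_of_le_smul_restrict_cube ENNReal.ofReal_ne_top hν hf
  have hkc := hχ.continuous_perpGrad hR
  have hGc : Continuous fun w : Phase => ((R + ‖z'.1 - w.1‖) ^ 2)⁻¹ :=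
    Continuous.inv₀ (by fun_prop) fun w => by positivity
  have h1 := norm_setIntegral_sub_le_of_blocks (μ := μ) (ν := ν) (B := innerBox lx lp L)
    measurableSet_innerBox (pairwise_disjoint_innerBox hlx hlp)
    (fun m => (ave_innerBox hlx hlp m).symm) (fun m => measure_ne_top _ _)
    (F := fun w => perpGrad χ R (z.1 - w.1)) (F' := fun w => perpGrad χ R (z'.1 - w.1))
    (G := fun w => C * (4 * lx) * ((R + ‖z'.1 - w.1‖) ^ 2)⁻¹) ?_
    (hint' (hkc.comp (by fun_prop))).integrableOn (hint (by fun_prop)).integrableOn ?_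
  · change ‖_ - ∫ w in innerRegion lx lp L, _ ∂ν‖ ≤ ∫ w in innerRegion lx lp L, _ ∂ν at h1
    rw [ave_restrict_inner] at h1
    refine h1.trans ?_
    have hi2 := integral_inv_sq_sq hR z'.1
    -- This value of the bathtub parameter balances t⁻¹ T against t R⁻², both becoming of order
    -- R⁻¹√(1+T).
    have ht : 0 < R * √(1 + T) := by positivity
    have h2 := integral_fst_le_of_density_le hM
      (hν.trans (smul_restrict_le _ _)) ha.measurable
      (G := fun y => ((R + ‖z'.1 - y‖) ^ 2)⁻¹) (by fun_prop) (fun y => by positivity) ht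
      (hint (by fun_prop)) hi2.1
    rw [integral_const_mul]
    rw [hi2.2] at h2
    have h3 : (R * √(1 + T))⁻¹ * T ≤ R⁻¹ * √(1 + T) := by
      have hs : √(1 + T) * √(1 + T) = 1 + T := Real.mul_self_sqrt (by linarith)
      rw [mul_inv, mul_assoc]
      gcongr
      rw [inv_mul_le_iff₀ (by positivity), hs]; linarith
    have h4 : M * (Real.pi * (R * √(1 + T)) * ((R ^ 2)⁻¹ * J))
        = M * (Real.pi * J) * (R⁻¹ * √(1 + T)) := by field_simp
    calc C * (4 * lx) * ∫ w, ((R + ‖z'.1 - w.1‖) ^ 2)⁻¹ ∂ν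
        ≤ C * (4 * lx) * ((1 + M * (Real.pi * J)) * (R⁻¹ * √(1 + T))) := by
          gcongr
          refine h2.trans ?_
          rw [h4, add_mul, one_mul]
          gcongr
      _ = _ := by ring
  · refine (Integrable.of_bound (C := C / R) ?_ ?_)
    · exact (hkc.comp (by fun_prop)).aestronglyMeasurable
    · refine Eventually.of_forall fun w => ((hk R hR).1 _).trans ?_
      gcongr
      linarith [norm_nonneg (z.1 - w.1)]
  · intro m' w hw w' hw'
    have h5 := (norm_sub_le_of_mem_box hz hz').1
    have h6 := (norm_sub_le_of_mem_box hw hw').1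
    -- The evaluation point and the source point each move within one box, by at most 2 lx; hence
    -- the hypothesis 4 lx ≤ R.
    have h7 : ‖z'.1 - w'.1 - (z.1 - w.1)‖ ≤ 4 * lx := by
      have : z'.1 - w'.1 - (z.1 - w.1) = -(z.1 - z'.1) + (w.1 - w'.1) := by abel
      rw [this]
      refine (norm_add_le _ _).trans ?_
      rw [norm_neg]; linarith
    rw [norm_sub_rev]
    refine ((hk R hR).2 _ _ (h7.trans hlR)).trans ?_
    rw [div_eq_mul_inv]
    gcongr

end Average


/-! ### Energy of the average against the inner energy, and the latter against the full energy. -/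

section Comparison

variable {Ae : Plane → Plane} {V : Plane → ℝ} {s : ℝ} {χ : Plane → ℝ}

/-- The energy of the part of `μ` in the boxes inside the cube. -/
def innerEnergy (Ae : Plane → Plane) (V : Plane → ℝ) (β : ℝ) (χ : Plane → ℝ) (R lx lp L : ℝ)
    (μ : Measure Phase) : ℝ :=
  (∫ z in innerRegion lx lp L,
      ‖z.2 + Ae z.1 + β • phaseField χ R (μ.restrict (innerRegion lx lp L)) z.1‖ ^ 2 ∂μ)
    + ∫ z in innerRegion lx lp L, V z.1 ∂μ

theorem norm_add_sq_le {E : Type*} [NormedAddCommGroup E] (u v : E) {κ : ℝ} (hκ : 0 < κ) :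
    ‖u + v‖ ^ 2 ≤ (1 + κ) * ‖u‖ ^ 2 + (1 + κ⁻¹) * ‖v‖ ^ 2 := by
  have h1 : ‖u + v‖ ^ 2 ≤ (‖u‖ + ‖v‖) ^ 2 := by gcongr; exact norm_add_le u v
  have h2 : 0 ≤ κ⁻¹ * (κ * ‖u‖ - ‖v‖) ^ 2 := by positivity
  have h3 : κ⁻¹ * (κ * ‖u‖ - ‖v‖) ^ 2 = κ * ‖u‖ ^ 2 - 2 * ‖u‖ * ‖v‖ + κ⁻¹ * ‖v‖ ^ 2 := by
    field_simp; ring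
  nlinarith

/-- Within a box the velocity p + Ae + βA changes by at most κ√(1+T), and V changes by at most
κ(1+V). The energy of the average stays on the right with a small factor, to be absorbed later. -/
theorem ExternalPotentials.exists_vlasovEnergy_ave_le (h : ExternalPotentials Ae V s)
    (hχ : SmearingProfile χ) (β : ℝ) {M : ℝ} (hM : 0 ≤ M) :
    ∃ K : ℝ, 0 < K ∧ ∀ (R lx lp L : ℝ) (N : ℕ) (Z : Fin N → Phase),
      0 < R → 0 < lx → 0 < lp → 4 * lx ≤ R → 2 * lx ≤ 1 → 1 ≤ N →
      ave lx lp L (emp Z) ≤ ENNReal.ofReal M • volume.restrict (cube L) →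
      ∀ κ, κ = K * (lx + lp + lx / R) →
        vlasovEnergy Ae V β χ R (ave lx lp L (emp Z))
          ≤ (1 + κ) * innerEnergy Ae V β χ R lx lp L (emp Z)
            + (2 * κ + κ ^ 2) * (1 + vlasovEnergy Ae V β χ R (ave lx lp L (emp Z))) := by
  obtain ⟨K₁, hK₁, hF⟩ := hχ.exists_phaseField_sub_le hM
  obtain ⟨K₂, hK₂, hA⟩ := h.exists_lipschitz_Ae
  obtain ⟨K₃, hK₃, hV⟩ := h.exists_V_le
  refine ⟨2 + 2 * K₂ + 2 * K₃ + |β| * K₁, by positivity, ?_⟩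
  intro R lx lp L N Z hR hlx hlp hlR hlx1 hN hν κ hκ
  set μ := emp Z with hμ
  set ν := ave lx lp L μ with hνdef
  have : IsProbabilityMeasure μ := isProbabilityMeasure_emp Z hN
  have hVc : Continuous V := h.differentiable_V.continuous
  have hAc : Continuous Ae := h.differentiable_Ae.continuous
  have hint : ∀ {f : Phase → ℝ}, Continuous f → Integrable f ν := fun hf =>
    integrable_of_le_smul_restrict_cube ENNReal.ofReal_ne_top hν hf
  have hνfin : IsFiniteMeasure ν := ⟨by
    rw [hνdef, ave_univ hlx hlp]; exact measure_lt_top _ _⟩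
  have hfc := continuous_phaseField hχ hR ν
  have hκ0 : 0 < κ := by rw [hκ]; positivity
  have hdiv : 0 < lx / R := by positivity
  rw [vlasovEnergy_eq hVc β hχ hR, innerEnergy]
  set T := ∫ z, ‖z.2 + Ae z.1 + β • phaseField χ R ν z.1‖ ^ 2 ∂ν with hT
  set T' := ∫ z in innerRegion lx lp L,
    ‖z.2 + Ae z.1 + β • phaseField χ R (μ.restrict (innerRegion lx lp L)) z.1‖ ^ 2 ∂μ with hT'
  set W := ∫ z, V z.1 ∂ν with hW
  set W' := ∫ z in innerRegion lx lp L, V z.1 ∂μ with hW'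
  have hT0 : 0 ≤ T := integral_nonneg fun z => by positivity
  have hT'0 : 0 ≤ T' := integral_nonneg fun z => by positivity
  have hW0 : 0 ≤ W := integral_nonneg fun z => h.nonneg_V _
  have hW'0 : 0 ≤ W' := integral_nonneg fun z => h.nonneg_V _
  have hmass : μ.real (innerRegion lx lp L) ≤ 1 := measureReal_le_one
  have hcmp : ∀ f g : Phase → ℝ, Continuous f → (∀ m, box lx lp m ⊆ cube L →
      ∀ z ∈ box lx lp m, ∀ z' ∈ box lx lp m, f z ≤ g z') →
      ∫ z, f z ∂ν ≤ ∫ z in innerRegion lx lp L, g z ∂μ := by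
    intro f g hf hfg
    have h1 := setIntegral_le_setIntegral_of_blocks (μ := ν) (ν := μ) (B := innerBox lx lp L)
      measurableSet_innerBox (pairwise_disjoint_innerBox hlx hlp)
      (fun m => ave_innerBox hlx hlp m) (fun m => measure_ne_top _ _)
      (hint hf).integrableOn (integrable_emp Z hN g).integrableOn
      fun m z hz z' hz' => hfg m.1 m.2 z hz z' hz'
    change ∫ z in innerRegion lx lp L, f z ∂ν ≤ _ at h1
    rwa [ave_restrict_inner] at h1
  have hkin : T ≤ (1 + κ) * T' + (κ + κ ^ 2) * (1 + T) := by
    have h1 := hcmp (fun z => ‖z.2 + Ae z.1 + β • phaseField χ R ν z.1‖ ^ 2)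
      (fun z => (1 + κ) * ‖z.2 + Ae z.1
        + β • phaseField χ R (μ.restrict (innerRegion lx lp L)) z.1‖ ^ 2 + (κ + κ ^ 2) * (1 + T))
      (by fun_prop) ?_
    · rw [integral_add ((integrable_emp Z hN _).integrableOn) (integrable_const _),
        integral_const_mul, setIntegral_const, smul_eq_mul] at h1
      refine h1.trans ?_
      have : μ.real (innerRegion lx lp L) * ((κ + κ ^ 2) * (1 + T)) ≤ 1 * ((κ + κ ^ 2) * (1 + T)) := by
        gcongr
      linarith
    · intro m hm z hz z' hz'
      set u' := z'.2 + Ae z'.1 + β • phaseField χ R (μ.restrict (innerRegion lx lp L)) z'.1 with hu'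
      set u := z.2 + Ae z.1 + β • phaseField χ R ν z.1 with hu
      have h2 := norm_sub_le_of_mem_box hz hz'
      -- With `a` the full vector potential generated by ν, the bathtub energy is T itself, not a
      -- separate bound on the momenta.
      have h3 := hF R lx lp L μ (fun x => Ae x + β • phaseField χ R ν x) hR hlx hlp hlR
        (by fun_prop) hν m hm z' hz' z hz
      simp only [← add_assoc] at h3
      rw [← hT, norm_sub_rev] at h3
      have h4 : 1 ≤ √(1 + T) := Real.one_le_sqrt.2 (by linarith)
      have h5 : ‖u - u'‖ ≤ κ * √(1 + T) := by
        have e : u - u' = (z.2 - z'.2) + (Ae z.1 - Ae z'.1) + β • (phaseField χ R ν z.1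
            - phaseField χ R (μ.restrict (innerRegion lx lp L)) z'.1) := by
          rw [hu, hu', smul_sub]; abel
        rw [e]
        have h6 : ‖Ae z.1 - Ae z'.1‖ ≤ 2 * K₂ * lx :=
          (hA _ _).trans (by nlinarith [h2.1])
        refine (norm_add₃_le).trans ?_
        rw [norm_smul, Real.norm_eq_abs]
        calc _ ≤ 2 * lp * 1 + 2 * K₂ * lx * 1 + |β| * (K₁ * (lx / R) * √(1 + T)) := by
              gcongr
              · linarith [h2.2]
              · linarith
          _ ≤ 2 * lp * √(1 + T) + 2 * K₂ * lx * √(1 + T) + |β| * (K₁ * (lx / R) * √(1 + T)) := by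
              gcongr
          _ = (2 * lp + 2 * K₂ * lx + |β| * K₁ * (lx / R)) * √(1 + T) := by ring
          _ ≤ κ * √(1 + T) := by
              gcongr
              rw [hκ]
              have : 0 ≤ |β| * K₁ := by positivity
              nlinarith [mul_pos hK₂ hlp, mul_pos hK₃ hlp, mul_pos hK₃ hlx, mul_pos hK₂ hdiv,
                mul_pos hK₃ hdiv, mul_nonneg this hlp.le, mul_nonneg this hlx.le]
      have h7 := norm_add_sq_le u' (u - u') hκ0
      rw [add_sub_cancel] at h7
      refine h7.trans ?_
      refine add_le_add_right ?_ _
      -- Taking the Young parameter equal to the relative error κ leaves an error linear in κ.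
      calc (1 + κ⁻¹) * ‖u - u'‖ ^ 2 ≤ (1 + κ⁻¹) * (κ * √(1 + T)) ^ 2 := by gcongr
        _ = (κ + κ ^ 2) * (1 + T) := by
          rw [mul_pow, Real.sq_sqrt (by linarith)]; field_simp; ring
  have hpot : W ≤ (1 + κ) * W' + κ := by
    have h1 := hcmp (fun z => V z.1) (fun z => (1 + κ) * V z.1 + κ) (by fun_prop) ?_
    · rw [integral_add ((integrable_emp Z hN _).integrableOn) (integrable_const _),
        integral_const_mul, setIntegral_const, smul_eq_mul] at h1
      nlinarith
    · intro m _ z hz z' hz'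
      have h2 := (norm_sub_le_of_mem_box hz hz').1
      refine (hV z.1 z'.1 (h2.trans hlx1)).trans ?_
      have h3 := h.nonneg_V z'.1
      have h4 : K₃ * ‖z.1 - z'.1‖ ≤ κ := by
        have : K₃ * ‖z.1 - z'.1‖ ≤ K₃ * (2 * lx) := by gcongr
        refine this.trans ?_
        rw [hκ]
        have : 0 ≤ |β| * K₁ := by positivity
        nlinarith [mul_pos hK₂ hlp, mul_pos hK₃ hlp, mul_pos hK₂ hlx, mul_pos hK₂ hdiv,
                mul_pos hK₃ hdiv, mul_nonneg this hlp.le, mul_nonneg this hlx.le,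
                mul_nonneg this hdiv.le]
      nlinarith
  nlinarith [mul_nonneg (show 0 ≤ κ + κ ^ 2 by positivity) hW0]

/-- Discarding the outer particles only lowers the nonnegative integrals. Removing their field is a
uniform perturbation of size at most |β| C/R times their mass, paid for by (1-σ)‖u‖² ≤ ‖u+v‖² +
σ⁻¹‖v‖². -/
theorem SmearingProfile.exists_innerEnergy_le (hχ : SmearingProfile χ)
    (h : ExternalPotentials Ae V s) (β : ℝ) :
    ∃ K : ℝ, 0 < K ∧ ∀ (R lx lp L σ : ℝ) (N : ℕ) (Z : Fin N → Phase),
      0 < R → 0 < σ → 1 ≤ N →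
      (1 - σ) * innerEnergy Ae V β χ R lx lp L (emp Z)
        ≤ vlasovEnergy Ae V β χ R (emp Z)
          + K * ((emp Z).real (innerRegion lx lp L)ᶜ ^ 2 / (σ * R ^ 2)) := by
  obtain ⟨C, hC, hk⟩ := hχ.exists_bound_perpGrad
  refine ⟨(|β| * C) ^ 2 + 1, by positivity, ?_⟩
  intro R lx lp L σ N Z hR hσ hN
  set μ := emp Z with hμ
  set U := innerRegion lx lp L with hU
  have : IsProbabilityMeasure μ := isProbabilityMeasure_emp Z hN
  have hVc : Continuous V := h.differentiable_V.continuous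
  have hUm : MeasurableSet U := measurableSet_inner
  rw [vlasovEnergy_eq hVc β hχ hR, innerEnergy, ← hU]
  have hsplit : ∀ x, phaseField χ R μ x
      = phaseField χ R (μ.restrict U) x + phaseField χ R (μ.restrict Uᶜ) x := fun x =>
    (integral_add_compl hUm (integrable_emp Z hN _)).symm
  set δ := |β| * (C / R * μ.real Uᶜ) with hδ
  have hout : ∀ x, ‖β • phaseField χ R (μ.restrict Uᶜ) x‖ ≤ δ := by
    intro x
    rw [norm_smul, Real.norm_eq_abs, hδ]
    gcongr
    refine norm_setIntegral_le_of_norm_le_const (measure_lt_top _ _) fun z _ => ?_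
    refine ((hk R hR).1 _).trans ?_
    gcongr
    linarith [norm_nonneg (x - z.1)]
  have hpt : ∀ z : Phase, (1 - σ) * ‖z.2 + Ae z.1 + β • phaseField χ R (μ.restrict U) z.1‖ ^ 2
      ≤ ‖z.2 + Ae z.1 + β • phaseField χ R μ z.1‖ ^ 2 + σ⁻¹ * δ ^ 2 := by
    intro z
    rw [hsplit, smul_add, ← add_assoc]
    set u := z.2 + Ae z.1 + β • phaseField χ R (μ.restrict U) z.1
    set v := β • phaseField χ R (μ.restrict Uᶜ) z.1 with hv
    have h1 : ‖v‖ ^ 2 ≤ δ ^ 2 := by gcongr; exact hout _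
    have h2 : (‖u‖ - ‖v‖) ^ 2 ≤ ‖u + v‖ ^ 2 := by
      rw [← sq_abs (‖u‖ - ‖v‖)]
      gcongr
      have := abs_norm_sub_norm_le u (-v)
      rwa [norm_neg, sub_neg_eq_add] at this
    have h3 : 0 ≤ σ⁻¹ * (σ * ‖u‖ - ‖v‖) ^ 2 := by positivity
    have h4 : σ⁻¹ * (σ * ‖u‖ - ‖v‖) ^ 2 = σ * ‖u‖ ^ 2 - 2 * ‖u‖ * ‖v‖ + σ⁻¹ * ‖v‖ ^ 2 := by
      field_simp; ring
    have h5 : σ⁻¹ * ‖v‖ ^ 2 ≤ σ⁻¹ * δ ^ 2 := by gcongr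
    nlinarith [sq_nonneg ‖v‖]
  have hkin : (1 - σ) * ∫ z in U, ‖z.2 + Ae z.1 + β • phaseField χ R (μ.restrict U) z.1‖ ^ 2 ∂μ
      ≤ ∫ z, ‖z.2 + Ae z.1 + β • phaseField χ R μ z.1‖ ^ 2 ∂μ + σ⁻¹ * δ ^ 2 := by
    rw [← integral_const_mul]
    calc _ ≤ ∫ z in U, (‖z.2 + Ae z.1 + β • phaseField χ R μ z.1‖ ^ 2 + σ⁻¹ * δ ^ 2) ∂μ :=
          integral_mono (integrable_emp Z hN _).integrableOn (integrable_emp Z hN _).integrableOn hpt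
      _ ≤ ∫ z, (‖z.2 + Ae z.1 + β • phaseField χ R μ z.1‖ ^ 2 + σ⁻¹ * δ ^ 2) ∂μ :=
          setIntegral_le_integral (integrable_emp Z hN _)
            (Eventually.of_forall fun z => by positivity)
      _ = _ := by
          rw [integral_add (integrable_emp Z hN _) (integrable_const _), integral_const]
          simp [hμ]
  have hpot : ∫ z in U, V z.1 ∂μ ≤ ∫ z, V z.1 ∂μ :=
    setIntegral_le_integral (integrable_emp Z hN _) (Eventually.of_forall fun z => h.nonneg_V _)
  have hpot0 : 0 ≤ ∫ z in U, V z.1 ∂μ := integral_nonneg fun z => h.nonneg_V _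
  have e : σ⁻¹ * δ ^ 2 = (|β| * C) ^ 2 * (μ.real Uᶜ ^ 2 / (σ * R ^ 2)) := by
    rw [hδ]; field_simp
  have h0 : 0 ≤ μ.real Uᶜ ^ 2 / (σ * R ^ 2) := by positivity
  nlinarith

end Comparison


/-! ### Cubes of bounded size. -/

section SmallCube

variable {Ae : Plane → Plane} {V : Plane → ℝ} {s : ℝ} {χ : Plane → ℝ}

/-- The kernel is dominated by C/|x|, locally integrable in the plane, and bounded density on a
bounded cube bounds the position density. Hence the bound is uniform in R. -/
theorem SmearingProfile.exists_phaseField_le (hχ : SmearingProfile χ) {M : ℝ} (hM : 0 ≤ M)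
    (r : ℝ) :
    ∃ K : ℝ, 0 < K ∧ ∀ (R L : ℝ) (ν : Measure Phase), 0 < R → 2 * L ≤ r →
      ν ≤ ENNReal.ofReal M • volume.restrict (cube L) →
      ∀ x, ‖x‖ ≤ r → ‖phaseField χ R ν x‖ ≤ K := by
  obtain ⟨C, hC, hk⟩ := hχ.exists_bound_perpGrad
  set g : Plane → ℝ := (Metric.ball 0 (2 * r + 1)).indicator fun y => ‖y‖⁻¹ with hg
  have hgi : Integrable g :=
    (integrable_indicator_iff measurableSet_ball).2 (integrableOn_inv_norm_ball _)
  have hg0 : ∀ y, 0 ≤ g y := Set.indicator_nonneg fun y _ => by positivity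
  set B : Set Plane := Metric.closedBall 0 r with hB
  have hJ : 0 ≤ ∫ y, g y := integral_nonneg hg0
  refine ⟨M * (C * (∫ y, g y) * volume.real B) + 1, by positivity, ?_⟩
  intro R L ν hR hL hν x hx
  have hcube : cube L ⊆ B ×ˢ B := by
    intro z hz
    constructor
    · exact mem_closedBall_zero_iff.2 ((norm_le_of_abs_le hz.1).trans hL)
    · exact mem_closedBall_zero_iff.2 ((norm_le_of_abs_le hz.2).trans hL)
  have hν' : ν ≤ ENNReal.ofReal M • volume.restrict (B ×ˢ B) := by
    refine hν.trans ?_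
    gcongr
  have hc : Continuous fun y : Plane => C / (R + ‖x - y‖) :=
    continuous_const.div (by fun_prop) fun y => by positivity
  have hi1 : IntegrableOn (fun y : Plane => C / (R + ‖x - y‖)) B :=
    hc.continuousOn.integrableOn_compact (isCompact_closedBall _ _)
  have hi : Integrable (fun z : Phase => C / (R + ‖x - z.1‖))
      (ENNReal.ofReal M • volume.restrict (B ×ˢ B)) := by
    refine Integrable.smul_measure ?_ ENNReal.ofReal_ne_top
    exact ((hc.comp continuous_fst).continuousOn).integrableOn_compact
      ((isCompact_closedBall _ _).prod (isCompact_closedBall _ _))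
  have h1 : ‖phaseField χ R ν x‖ ≤ ∫ z : Phase, C / (R + ‖x - z.1‖) ∂ν :=
    norm_integral_le_of_norm_le (hi.mono_measure hν') (Eventually.of_forall fun z => (hk R hR).1 _)
  have h2 : ∫ z : Phase, C / (R + ‖x - z.1‖) ∂ν
      ≤ M * ∫ z : Phase in B ×ˢ B, C / (R + ‖x - z.1‖) := by
    refine (integral_mono_measure hν' (Eventually.of_forall fun z => ?_) hi).trans_eq ?_
    · simp only [Pi.zero_apply]; positivity
    · rw [integral_smul_measure, ENNReal.toReal_ofReal hM, smul_eq_mul]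
  have h3 : ∫ z : Phase in B ×ˢ B, C / (R + ‖x - z.1‖)
      = (∫ y in B, C / (R + ‖x - y‖)) * volume.real B := by
    have := setIntegral_prod_mul (μ := (volume : Measure Plane)) (ν := (volume : Measure Plane))
      (fun y => C / (R + ‖x - y‖)) (fun _ => (1 : ℝ)) B B
    simpa [← Measure.volume_eq_prod] using this
  have h4 : ∫ y in B, C / (R + ‖x - y‖) ≤ C * ∫ y, g y := by
    rw [← integral_sub_left_eq_self g volume x, ← integral_const_mul]
    have hgi' : Integrable fun y => C * g (x - y) := (hgi.comp_sub_left x).const_mul C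
    refine le_trans (setIntegral_mono_ae_restrict hi1 hgi'.integrableOn ?_)
      (setIntegral_le_integral hgi' (Eventually.of_forall fun y => mul_nonneg hC.le (hg0 _)))
    have hae : ∀ᵐ y : Plane, y ≠ x := Measure.ae_ne volume x
    filter_upwards [ae_restrict_of_ae hae, ae_restrict_mem Metric.isClosed_closedBall.measurableSet]
      with y hy hyB
    have h5 : ‖y‖ ≤ r := mem_closedBall_zero_iff.1 hyB
    have h6 : x - y ∈ Metric.ball (0 : Plane) (2 * r + 1) := by
      rw [mem_ball_zero_iff]
      linarith [norm_sub_le x y]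
    have h7 : 0 < ‖x - y‖ := norm_pos_iff.2 (sub_ne_zero.2 hy.symm)
    rw [hg, Set.indicator_of_mem h6, div_eq_mul_inv]
    gcongr
    linarith
  calc ‖phaseField χ R ν x‖ ≤ M * ((∫ y in B, C / (R + ‖x - y‖)) * volume.real B) := by
        rw [← h3]; exact h1.trans h2
    _ ≤ M * (C * (∫ y, g y) * volume.real B) := by gcongr
    _ ≤ _ := by linarith

theorem ExternalPotentials.exists_vlasovEnergy_le_mass (h : ExternalPotentials Ae V s)
    (hχ : SmearingProfile χ) (β : ℝ) {M : ℝ} (hM : 0 ≤ M) (r : ℝ) (hr : 0 ≤ r) :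
    ∃ K : ℝ, 0 < K ∧ ∀ (R L : ℝ) (ν : Measure Phase) [IsFiniteMeasure ν], 0 < R → 2 * L ≤ r →
      ν ≤ ENNReal.ofReal M • volume.restrict (cube L) →
      vlasovEnergy Ae V β χ R ν ≤ K * ν.real Set.univ := by
  obtain ⟨K₁, hK₁, hF⟩ := hχ.exists_phaseField_le hM r
  obtain ⟨K₂, hA⟩ := h.bounded_Ae
  have hVc : Continuous V := h.differentiable_V.continuous
  have hAc : Continuous Ae := h.differentiable_Ae.continuous
  obtain ⟨K₃, hV⟩ := (isCompact_closedBall (0 : Plane) r).exists_bound_of_continuousOn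
    hVc.continuousOn
  have hK₂ : 0 ≤ K₂ := (norm_nonneg _).trans (hA 0)
  have hK₃ : 0 ≤ K₃ := (norm_nonneg _).trans (hV 0 (by simpa using hr))
  refine ⟨(r + K₂ + |β| * K₁) ^ 2 + K₃ + 1, by positivity, ?_⟩
  intro R L ν _ hR hL hν
  have hfc := continuous_phaseField hχ hR ν
  have hint : ∀ {f : Phase → ℝ}, Continuous f → Integrable f ν := fun hf =>
    integrable_of_le_smul_restrict_cube ENNReal.ofReal_ne_top hν hf
  have hmem : ∀ᵐ z ∂ν, z ∈ cube L :=
    (Measure.absolutelyContinuous_of_le hν).ae_le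
      (Measure.ae_smul_measure (ae_restrict_mem (measurableSet_cube L)) _)
  rw [vlasovEnergy_eq hVc β hχ hR, ← integral_add (hint (by fun_prop)) (hint (by fun_prop))]
  have h1 : ∫ z, (‖z.2 + Ae z.1 + β • phaseField χ R ν z.1‖ ^ 2 + V z.1) ∂ν
      ≤ ∫ _, ((r + K₂ + |β| * K₁) ^ 2 + K₃ + 1) ∂ν := by
    refine integral_mono_ae (hint (by fun_prop)) (integrable_const _) ?_
    filter_upwards [hmem] with z hz
    have hx : ‖z.1‖ ≤ r := (norm_le_of_abs_le hz.1).trans hL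
    have hp : ‖z.2‖ ≤ r := (norm_le_of_abs_le hz.2).trans hL
    have h2 : ‖z.2 + Ae z.1 + β • phaseField χ R ν z.1‖ ≤ r + K₂ + |β| * K₁ := by
      refine norm_add₃_le.trans ?_
      rw [norm_smul, Real.norm_eq_abs]
      gcongr
      · exact hA _
      · exact hF R L ν hR hL hν _ hx
    have h3 : V z.1 ≤ K₃ := (le_abs_self _).trans (hV z.1 (by simpa using hx))
    have h4 : ‖z.2 + Ae z.1 + β • phaseField χ R ν z.1‖ ^ 2 ≤ (r + K₂ + |β| * K₁) ^ 2 := by gcongr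
    linarith
  rw [integral_const, smul_eq_mul, mul_comm] at h1
  exact h1

/-- Bathtub bound with G the indicator of a disc containing all positions: bounded density and small
kinetic energy force small mass. The term 8 lp² is the cost of moving momenta within a box. -/
theorem exists_ave_mass_le {M : ℝ} (hM : 0 ≤ M) (r : ℝ) :
    ∃ K : ℝ, 0 < K ∧ ∀ (lx lp L : ℝ) (N : ℕ) (Z : Fin N → Phase),
      0 < lx → 0 < lp → 1 ≤ N → 2 * L ≤ r →
      ave lx lp L (emp Z) ≤ ENNReal.ofReal M • volume.restrict (cube L) →
      ∀ t, 0 < t → (ave lx lp L (emp Z)).real Set.univ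
        ≤ t⁻¹ * (2 * ∫ z, ‖z.2‖ ^ 2 ∂(emp Z) + 8 * lp ^ 2) + K * t := by
  set B : Set Plane := Metric.closedBall 0 r with hB
  have hBm : MeasurableSet B := Metric.isClosed_closedBall.measurableSet
  have hBfin : volume B ≠ ⊤ := (isCompact_closedBall (0 : Plane) r).measure_lt_top.ne
  refine ⟨M * (Real.pi * volume.real B) + 1, by positivity, ?_⟩
  intro lx lp L N Z hlx hlp hN hL hν t ht
  set μ := emp Z with hμ
  set ν := ave lx lp L μ with hνdef
  have : IsProbabilityMeasure μ := isProbabilityMeasure_emp Z hN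
  have hνfin : IsFiniteMeasure ν := ⟨by
    rw [hνdef, ave_univ hlx hlp]; exact measure_lt_top _ _⟩
  have hint : ∀ {f : Phase → ℝ}, Continuous f → Integrable f ν := fun hf =>
    integrable_of_le_smul_restrict_cube ENNReal.ofReal_ne_top hν hf
  have hmem : ∀ᵐ z ∂ν, z ∈ cube L :=
    (Measure.absolutelyContinuous_of_le hν).ae_le
      (Measure.ae_smul_measure (ae_restrict_mem (measurableSet_cube L)) _)
  set G : Plane → ℝ := B.indicator fun _ => 1 with hG
  have hG2 : (fun x => G x ^ 2) = G := by
    funext x; by_cases hx : x ∈ B <;> simp [hG, hx]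
  have h1 := integral_fst_le_of_density_le hM (hν.trans (smul_restrict_le _ _))
    (a := fun _ => 0) measurable_const (G := G) (measurable_const.indicator hBm)
    (Set.indicator_nonneg fun _ _ => zero_le_one) ht (hint (by fun_prop))
    (by rw [hG2]; exact (integrable_indicator_iff hBm).2 (integrableOn_const hBfin))
  have h2 : ∫ z : Phase, G z.1 ∂ν = ν.real Set.univ := by
    rw [integral_congr_ae (g := fun _ => (1 : ℝ)), integral_const, smul_eq_mul, mul_one]
    filter_upwards [hmem] with z hz
    exact Set.indicator_of_mem
      (show z.1 ∈ B from mem_closedBall_zero_iff.2 ((norm_le_of_abs_le hz.1).trans hL)) _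
  have h3 : ∫ x, G x ^ 2 = volume.real B := by
    rw [hG2, hG, integral_indicator_const _ hBm, smul_eq_mul, mul_one]
  have h4 := setIntegral_le_setIntegral_of_blocks (μ := ν) (ν := μ) (B := innerBox lx lp L)
      measurableSet_innerBox (pairwise_disjoint_innerBox hlx hlp)
      (fun m => ave_innerBox hlx hlp m) (fun m => measure_ne_top _ _)
      (f := fun z => ‖z.2‖ ^ 2) (g := fun z => 2 * ‖z.2‖ ^ 2 + 8 * lp ^ 2)
      (hint (by fun_prop)).integrableOn (integrable_emp Z hN _).integrableOn
      fun m z hz z' hz' => by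
        have h5 := (norm_sub_le_of_mem_box hz hz').2
        have h6 : ‖z.2‖ ^ 2 ≤ (‖z'.2‖ + 2 * lp) ^ 2 := by
          gcongr; linarith [norm_sub_norm_le z.2 z'.2]
        nlinarith [sq_nonneg (‖z'.2‖ - 2 * lp)]
  change ∫ z in innerRegion lx lp L, _ ∂ν ≤ ∫ z in innerRegion lx lp L, _ ∂μ at h4
  rw [ave_restrict_inner] at h4
  have h5 : ∫ z in innerRegion lx lp L, (2 * ‖z.2‖ ^ 2 + 8 * lp ^ 2) ∂μ
      ≤ 2 * ∫ z, ‖z.2‖ ^ 2 ∂μ + 8 * lp ^ 2 := by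
    refine (setIntegral_le_integral (integrable_emp Z hN _)
      (Eventually.of_forall fun z => by positivity)).trans_eq ?_
    rw [integral_add (integrable_emp Z hN _) (integrable_const _), integral_const_mul,
      integral_const]
    simp [hμ]
  simp only [add_zero] at h1
  rw [h2, h3] at h1
  refine h1.trans ?_
  have h6 : t⁻¹ * ∫ z, ‖z.2‖ ^ 2 ∂ν ≤ t⁻¹ * (2 * ∫ z, ‖z.2‖ ^ 2 ∂μ + 8 * lp ^ 2) := by
    gcongr; exact h4.trans h5
  have h7 : M * (Real.pi * t * volume.real B) = M * (Real.pi * volume.real B) * t := by ring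
  rw [h7]
  linarith

end SmallCube

theorem ave_le_of_notMem_pauliViolating {N : ℕ} {lx lp L ε : ℝ} (hN : 1 ≤ N) (hlx : 0 < lx)
    (hlp : 0 < lp) (hε : 0 < ε) (Z : Fin N → Phase) (hZ : emp Z ∉ pauliViolating N lx lp L ε) :
    ave lx lp L (emp Z)
      ≤ ENNReal.ofReal ((1 + ε) / (2 * Real.pi) ^ 2) • volume.restrict (cube L) := by
  refine ave_le_of_box_le hlx hlp fun m hm => ?_
  have : IsProbabilityMeasure (emp Z) := isProbabilityMeasure_emp Z hN
  have h1 : (emp Z).real (box lx lp m)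
      ≤ (1 + ε) / (2 * Real.pi) ^ 2 * volume.real (box lx lp m) := by
    by_contra hcon
    exact hZ ⟨⟨Z, rfl⟩, m, hm, (not_le.1 hcon).le⟩
  have hfin : volume (box lx lp m) ≠ ⊤ :=
    ((measure_mono hm).trans_lt (volume_cube_lt_top L)).ne
  rw [← ENNReal.ofReal_toReal (measure_ne_top (emp Z) (box lx lp m)),
    ← ENNReal.ofReal_toReal hfin, ← ENNReal.ofReal_mul (by positivity)]
  exact ENNReal.ofReal_le_ofReal h1


/-! ### Markov's inequality and algebra for the final estimate. -/

section Assembly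

variable {Ae : Plane → Plane} {V : Plane → ℝ} {s : ℝ} {χ : Plane → ℝ}

theorem ExternalPotentials.vlasovEnergy_nonneg (h : ExternalPotentials Ae V s) (β R : ℝ)
    (μ : Measure Phase) : 0 ≤ vlasovEnergy Ae V β χ R μ :=
  add_nonneg (integral_nonneg fun z => by positivity) (integral_nonneg fun z => h.nonneg_V _)

theorem min_pow_four_rpow {L : ℝ} (hL : 0 < L) (s : ℝ) :
    min (L ^ 4) (L ^ (2 * s)) = min (L ^ 2) (L ^ s) ^ 2 := by
  have e1 : L ^ 4 = (L ^ 2) ^ 2 := by ring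
  have e2 : L ^ (2 * s) = (L ^ s) ^ 2 := by
    rw [← Real.rpow_natCast (L ^ s) 2, ← Real.rpow_mul hL.le]; congr 1; push_cast; ring
  have h2 : 0 ≤ L ^ s := by positivity
  rw [e1, e2]
  rcases le_total (L ^ 2) (L ^ s) with h | h
  · rw [min_eq_left h, min_eq_left (by gcongr)]
  · rw [min_eq_right h, min_eq_right (by gcongr)]

theorem ExternalPotentials.integral_energy_bounds (h : ExternalPotentials Ae V s)
    {N : ℕ} (hN : 1 ≤ N) (Z : Fin N → Phase) {D : ℝ}
    (hD : ∫ z, (‖z.2‖ ^ 2 + V z.1) ∂(emp Z) ≤ D) :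
    0 ≤ D ∧ ∫ z, ‖z.2‖ ^ 2 ∂(emp Z) ≤ D := by
  refine ⟨le_trans (integral_nonneg fun z => add_nonneg (by positivity) (h.nonneg_V _)) hD,
    le_trans (integral_mono (integrable_emp Z hN _) (integrable_emp Z hN _) fun z => ?_) hD⟩
  simpa using h.nonneg_V z.1

theorem mul_measureReal_compl_le {N : ℕ} (hN : 1 ≤ N) (Z : Fin N → Phase) {f : Phase → ℝ}
    (hf : ∀ z, 0 ≤ f z) {U : Set Phase} (hU : MeasurableSet U) {c : ℝ}
    (hc : ∀ z ∉ U, c ≤ f z) : c * (emp Z).real Uᶜ ≤ ∫ z, f z ∂(emp Z) := by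
  have : IsProbabilityMeasure (emp Z) := isProbabilityMeasure_emp Z hN
  calc c * (emp Z).real Uᶜ = ∫ _ in Uᶜ, c ∂(emp Z) := by
        rw [setIntegral_const, smul_eq_mul, mul_comm]
    _ ≤ ∫ z in Uᶜ, f z ∂(emp Z) :=
        setIntegral_mono_on (integrable_const _) (integrable_emp Z hN _).integrableOn hU.compl
          fun z hz => hc z hz
    _ ≤ ∫ z, f z ∂(emp Z) :=
        setIntegral_le_integral (integrable_emp Z hN _) (Eventually.of_forall hf)

/-- Solving the first bound for E gives (1-η)/(1+κ) E ≤ E' + η, which is then multiplied by 1 - σ ≥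
0. -/
theorem sub_le_of_relative_bounds {E E' F η κ σ err : ℝ} (hη : 0 ≤ η) (hκ : 0 ≤ κ) (hσ : 0 ≤ σ)
    (hσ1 : σ ≤ 1) (h1 : E ≤ (1 + κ) * E' + η * (1 + E)) (h2 : (1 - σ) * E' ≤ F + err) :
    (1 - σ) * ((1 - η) / (1 + κ)) * E - η - err ≤ F := by
  have h3 : (1 - η) / (1 + κ) * E ≤ E' + η := by
    rw [div_mul_eq_mul_div, div_le_iff₀ (by linarith)]
    nlinarith [mul_nonneg hη hκ]
  have h4 : (1 - σ) * ((1 - η) / (1 + κ)) * E ≤ (1 - σ) * (E' + η) := by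
    rw [mul_assoc]
    exact mul_le_mul_of_nonneg_left h3 (by linarith)
  nlinarith [mul_nonneg hσ hη]

end Assembly

end Anyons

end

/-! ### The main theorem. -/

theorem mainTheorem6
    (Ae : Anyons.Plane → Anyons.Plane) (V : Anyons.Plane → ℝ) (s : ℝ)
    (hext : Anyons.ExternalPotentials Ae V s)
    (χ : Anyons.Plane → ℝ) (hχ : Anyons.SmearingProfile χ) (β : ℝ) :
    ∃ C : ℝ, 0 < C ∧
      ∀ (b ε : ℝ) (R lx lp : ℕ → ℝ), 0 < b → b < 1 → 0 < ε →
        (∀ N, 1 ≤ N → 0 < R N ∧ 0 < lx N ∧ 0 < lp N) →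
        (∀ N, 1 ≤ N → lx N ^ 2 * lp N ^ 2 = (N : ℝ) ^ (-b)) →
        Tendsto R atTop (𝓝 0) →
        Tendsto (fun N => lx N / R N) atTop (𝓝 0) →
        Tendsto lp atTop (𝓝 0) →
        ∃ o₁ o₂ : ℕ → ℝ, Tendsto o₁ atTop (𝓝 0) ∧ Tendsto o₂ atTop (𝓝 0) ∧
          ∀ N : ℕ, 1 ≤ N → ∀ L : ℝ, 0 < L → ∀ (D : ℝ) (Z : Fin N → Anyons.Phase),
            Anyons.emp Z ∉ Anyons.pauliViolating N (lx N) (lp N) L ε →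
            ∫ z, (‖z.2‖ ^ 2 + V z.1) ∂(Anyons.emp Z) ≤ D →
            ∀ σ : ℝ, 0 < σ →
              (1 - σ) * (1 - o₁ N) *
                  Anyons.vlasovEnergy Ae V β χ (R N)
                    (Anyons.ave (lx N) (lp N) L (Anyons.emp Z))
                - o₂ N - C * (D ^ 2 / (σ * R N ^ 2 * min (L ^ 4) (L ^ (2 * s))))
              ≤ Anyons.vlasovEnergy Ae V β χ (R N) (Anyons.emp Z) := by
  classical
  obtain ⟨L₀, c, hL₀, hc, hout⟩ := hext.exists_le_of_notMem_inner
  obtain ⟨K, hK, hin⟩ := hχ.exists_innerEnergy_le hext β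
  -- Fixed before ε: K comes from Young's inequality, c from the lower bound outside the inner
  -- boxes. The constants K₁, K₂, K₃ below depend on ε.
  refine ⟨K / c ^ 2, by positivity, ?_⟩
  intro b ε R lx lp _ _ hε hpos _ hR hlxR hlp
  have hM : 0 ≤ (1 + ε) / (2 * Real.pi) ^ 2 := by positivity
  obtain ⟨K₁, hK₁, hcmp⟩ := hext.exists_vlasovEnergy_ave_le hχ β hM
  obtain ⟨K₂, hK₂, hE⟩ := hext.exists_vlasovEnergy_le_mass hχ β hM (2 * L₀) (by linarith)
  obtain ⟨K₃, hK₃, hmass⟩ := Anyons.exists_ave_mass_le hM (2 * L₀)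
  set κ : ℕ → ℝ := fun N => K₁ * (lx N + lp N + lx N / R N) with hκ
  set η : ℕ → ℝ := fun N => 2 * κ N + κ N ^ 2 with hη
  -- Chosen so that t² dominates 2D + 8 lp² once D < √R.
  set t : ℕ → ℝ := fun N => √(2 * √(R N) + 8 * lp N ^ 2) with ht
  set good : ℕ → Prop := fun N => 4 * lx N ≤ R N ∧ 2 * lx N ≤ 1 ∧ lp N ≤ 1 ∧ η N ≤ 1 ∧
    K₂ * (R N * L₀ ^ 4) ≤ K / c ^ 2 with hgood
  have hlx : Tendsto lx atTop (𝓝 0) := by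
    have h1 := hlxR.mul hR
    rw [zero_mul] at h1
    refine h1.congr' ?_
    filter_upwards [eventually_ge_atTop 1] with N hN
    exact div_mul_cancel₀ _ (hpos N hN).1.ne'
  have hκ0 : Tendsto κ atTop (𝓝 0) := by
    simpa using ((hlx.add hlp).add hlxR).const_mul K₁
  have hη0 : Tendsto η atTop (𝓝 0) := by
    simpa using (hκ0.const_mul 2).add (hκ0.pow 2)
  have ht0 : Tendsto t atTop (𝓝 0) := by
    have h1 : Tendsto (fun N => 2 * √(R N) + 8 * lp N ^ 2) atTop (𝓝 0) := by
      simpa using (hR.sqrt.const_mul 2).add ((hlp.pow 2).const_mul 8)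
    simpa using h1.sqrt
  have hev : ∀ᶠ N in atTop, good N := by
    have e1 : ∀ᶠ N in atTop, lx N / R N < 1 / 4 := hlxR.eventually_lt_const (by norm_num)
    have e2 : ∀ᶠ N in atTop, lx N < 1 / 2 := hlx.eventually_lt_const (by norm_num)
    have e3 : ∀ᶠ N in atTop, lp N < 1 := hlp.eventually_lt_const (by norm_num)
    have e4 : ∀ᶠ N in atTop, η N < 1 := hη0.eventually_lt_const (by norm_num)
    have e5 : ∀ᶠ N in atTop, K₂ * (R N * L₀ ^ 4) < K / c ^ 2 := by
      have : Tendsto (fun N => K₂ * (R N * L₀ ^ 4)) atTop (𝓝 0) := by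
        simpa using (hR.mul_const (L₀ ^ 4)).const_mul K₂
      exact this.eventually_lt_const (by positivity)
    filter_upwards [e1, e2, e3, e4, e5, eventually_ge_atTop 1] with N h1 h2 h3 h4 h5 hN
    rw [div_lt_iff₀ (hpos N hN).1] at h1
    exact ⟨by linarith, by linarith, h3.le, h4.le, h5.le⟩
  -- At the remaining N, finitely many, the value 1 kills the energy term and the claim reduces to
  -- positivity.
  refine ⟨fun N => if good N then 1 - (1 - η N) / (1 + κ N) else 1,
    fun N => η N + K₂ * ((1 + K₃) * t N), ?_, ?_, ?_⟩
  · have h1 : Tendsto (fun N => 1 - (1 - η N) / (1 + κ N)) atTop (𝓝 0) := by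
      have := (tendsto_const_nhds (x := (1 : ℝ))).sub
        (((tendsto_const_nhds (x := (1 : ℝ))).sub hη0).div
          ((tendsto_const_nhds (x := (1 : ℝ))).add hκ0) (by norm_num))
      simpa using this
    refine h1.congr' ?_
    filter_upwards [hev] with N hN
    rw [if_pos hN]
  · simpa using hη0.add ((ht0.const_mul (1 + K₃)).const_mul K₂)
  intro N hN L hL D Z hZ hD σ hσ
  obtain ⟨hRN, hlxN, hlpN⟩ := hpos N hN
  have hκN : 0 < κ N := by simp only [hκ]; positivity
  have hηN : 0 < η N := by simp only [hη]; positivity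
  have htN : 0 < t N := by simp only [ht]; positivity
  have : IsProbabilityMeasure (Anyons.emp Z) := Anyons.isProbabilityMeasure_emp Z hN
  set μ := Anyons.emp Z with hμ
  set ν := Anyons.ave (lx N) (lp N) L μ with hν
  have hνM := Anyons.ave_le_of_notMem_pauliViolating hN hlxN hlpN hε Z hZ
  have hEμ : 0 ≤ Anyons.vlasovEnergy Ae V β χ (R N) μ := hext.vlasovEnergy_nonneg β (R N) μ
  have hEν : 0 ≤ Anyons.vlasovEnergy Ae V β χ (R N) ν := hext.vlasovEnergy_nonneg β (R N) ν
  obtain ⟨hD0, hDp⟩ := hext.integral_energy_bounds hN Z hD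
  set m := min (L ^ 4) (L ^ (2 * s)) with hm
  have hm0 : 0 < m := by positivity
  have herr : 0 ≤ K / c ^ 2 * (D ^ 2 / (σ * R N ^ 2 * m)) := by positivity
  have ho₂ : 0 ≤ K₂ * ((1 + K₃) * t N) := by positivity
  by_cases hg : good N
  swap
  · simp only [if_neg hg]
    linarith
  simp only [if_pos hg, sub_sub_cancel]
  obtain ⟨hg1, hg2, hg3, hg4, hg5⟩ := hg
  have hq0 : 0 ≤ (1 - η N) / (1 + κ N) := div_nonneg (by linarith) (by linarith)
  have hq1 : (1 - η N) / (1 + κ N) ≤ 1 := (div_le_one (by linarith)).2 (by linarith)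
  rcases le_or_gt 1 σ with hσ1 | hσ1
  · have : (1 - σ) * ((1 - η N) / (1 + κ N)) * Anyons.vlasovEnergy Ae V β χ (R N) ν ≤ 0 :=
      mul_nonpos_of_nonpos_of_nonneg (mul_nonpos_of_nonpos_of_nonneg (by linarith) hq0) hEν
    linarith
  rcases le_or_gt L₀ L with hLL | hLL
  · have h1 := hcmp (R N) (lx N) (lp N) L N Z hRN hlxN hlpN hg1 hg2 hN hνM (κ N) rfl
    have h2 := hin (R N) (lx N) (lp N) L σ N Z hRN hσ hN
    rw [← hμ, ← hν] at h1
    rw [← hμ] at h2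
    have h4 := Anyons.mul_measureReal_compl_le hN Z (f := fun z => ‖z.2‖ ^ 2 + V z.1)
      (fun z => add_nonneg (by positivity) (hext.nonneg_V _)) Anyons.measurableSet_inner
      (hout L (lx N) (lp N) hLL hlxN (by linarith) hlpN hg3)
    rw [← hμ] at h4
    have h5 : K * (μ.real (Anyons.innerRegion (lx N) (lp N) L)ᶜ ^ 2 / (σ * R N ^ 2))
        ≤ K / c ^ 2 * (D ^ 2 / (σ * R N ^ 2 * m)) := by
      have h6 : (c * min (L ^ 2) (L ^ s) * μ.real (Anyons.innerRegion (lx N) (lp N) L)ᶜ) ^ 2 ≤ D ^ 2 := by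
        have : 0 ≤ c * min (L ^ 2) (L ^ s) := by positivity
        gcongr
        exact h4.trans hD
      rw [mul_pow, mul_pow, ← Anyons.min_pow_four_rpow hL, ← hm] at h6
      calc _ = K / c ^ 2 * (c ^ 2 * m * μ.real (Anyons.innerRegion (lx N) (lp N) L)ᶜ ^ 2
              / (σ * R N ^ 2 * m)) := by field_simp
        _ ≤ _ := by gcongr
    have h7 := Anyons.sub_le_of_relative_bounds hηN.le hκN.le hσ.le hσ1.le h1 (h2.trans
      (add_le_add_right h5 _))
    linarith
  · have hfin : IsFiniteMeasure ν := ⟨by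
      rw [hν, Anyons.ave_univ hlxN hlpN]; exact measure_lt_top _ _⟩
    have h1 := hE (R N) L ν hRN (by linarith) hνM
    have h2 : (1 - σ) * ((1 - η N) / (1 + κ N)) * Anyons.vlasovEnergy Ae V β χ (R N) ν
        ≤ Anyons.vlasovEnergy Ae V β χ (R N) ν :=
      mul_le_of_le_one_left hEν (mul_le_one₀ (by linarith) hq0 hq1)
    -- For D ≥ √R, the factor D²/R² is at least 1/R, so the error term alone beats the constant K₂;
    -- otherwise the mass of ν is of order t.
    rcases le_or_gt (√(R N)) D with hDR | hDR
    · have h3 : ν.real Set.univ ≤ 1 := by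
        rw [measureReal_def, hν, Anyons.ave_univ hlxN hlpN, ← measureReal_def]
        exact measureReal_le_one
      have h4 : R N ≤ D ^ 2 := by
        rw [← Real.sq_sqrt hRN.le]; gcongr
      have h5 : m ≤ L₀ ^ 4 := (min_le_left _ _).trans (by gcongr)
      have h6 : K₂ ≤ K / c ^ 2 * (D ^ 2 / (σ * R N ^ 2 * m)) := by
        rw [← mul_div_assoc, le_div_iff₀ (by positivity)]
        calc K₂ * (σ * R N ^ 2 * m) ≤ K₂ * (1 * R N ^ 2 * L₀ ^ 4) := by gcongr
          _ = K₂ * (R N * L₀ ^ 4) * R N := by ring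
          _ ≤ K / c ^ 2 * D ^ 2 := by gcongr
      nlinarith
    · have h3 := hmass (lx N) (lp N) L N Z hlxN hlpN hN (by linarith) hνM (t N) htN
      rw [← hμ, ← hν] at h3
      have h4 : (t N)⁻¹ * (2 * ∫ z, ‖z.2‖ ^ 2 ∂μ + 8 * lp N ^ 2) ≤ t N := by
        rw [inv_mul_le_iff₀ htN]
        have : t N * t N = 2 * √(R N) + 8 * lp N ^ 2 := Real.mul_self_sqrt (by positivity)
        rw [this]
        linarith
      have h5 : K₂ * ν.real Set.univ ≤ K₂ * ((1 + K₃) * t N) := by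
        gcongr
        linarith
      linarith
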